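/- **Setting.** Let $D$ be a division algebra of finite dimension over $\mathbb Q$ and $S=D\otimes_{\mathbb Q}\mathbb R=\prod_v D_v$, where $v$ runs over the archimedean places of the centre of $D$ and each $D_v$ is identified with a matrix algebra over $\mathbb R$, $\mathbb C$ or $\mathbb H$; let $*$ be the conjugate transpose in each factor, and let $\mathrm{Tr}\colon S\to\mathbb R$ be the sum of the traces of the $\mathbb R$-algebras $D_v$. Let $L_0\subset D^n$ be a $\mathbb Z$-lattice (a finitely generated group of row vectors containing a $\mathbb Q$-basis of $D^n$), let $\Gamma_0\subset G=\mathrm{GL}_n(S)$ be its stabilizer (acting on the right), and let $\varphi$ be a set of weights: a $\Gamma_0$-invariant positive function on the lines (rank-one left $D$-submodules) of $D^n$; write $\varphi(x)=\varphi(Dx)$. Let $a\in G$ satisfy $L_0a\subseteq L_0$, and put $M_0=L_0a$. For $\tau\ge 1$ and $x\in L_0\setminus\{0\}$ let $\varphi_\tau(x)=\varphi(x)$ if $x\in M_0$ and $\varphi_\tau(x)=\tau^2\varphi(x)$ if $x\notin M_0$. Let $E$ be the real vector space of Hermitian $n\times n$ matrices over $S$. For $Z\in E$ and $x\in S^n$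 write $Z[x]=\mathrm{Tr}(xZ(x^*)^t)$, and let $X=\{Z\in E: Z[x]>0\text{ for all }0\ne x\in S^n\}$ be the cone of positive definite matrices. *The fiber.* $\widetilde W_\tau$ is the set of $Z\in X$ such that $\min_{x\in L_0\setminus\{0\}}\varphi_\tau(x)Z[x]=1$ and such that the vectors $x\in L_0\setminus\{0\}$ attaining this minimum span $S^n$ as a left $S$-module. For a finite $M\subset L_0\setminus\{0\}$ let $\sigma_\tau(M)$ be the set of $Z\in X$ with $\varphi_\tau(x)Z[x]=1$ for $x\in M$ and $\varphi_\tau(x)Z[x]>1$ for $x\in L_0\setminus(M\cup\{0\})$. The cells of $\widetilde W_\tau$ are the closed polyhedra $$\overline{\sigma}_\tau(M)=\{Z\in X:\ \varphi_\tau(x)Z[x]=1\ (x\in M),\ \ \varphi_\tau(x)Z[x]\ge 1\ (x\in L_0\setminus\{0\})\}$$ for those $M$ with $\emptyset\ne\sigma_\tau(M)\subseteq\widetilde W_\tau$. *The Hecketope.* Let $\psi_\tau(x)=\varphi_\tau(x)\,\psi(x)\in E$, where $\psi(x)$ is the rank-one matrix with entries $\psi(x)_{ij}=x_i^*x_j$,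 and let $\mathcal H_\tau\subset E$ be the convex hull of the points $\psi_\tau(x)$, $x\in L_0\setminus\{0\}$. The Hecketope at $\tau$ is $\mathcal H_\tau\cap X$ (it generalizes the Voronoi polyhedron); its faces are the non-empty proper faces $F\subsetneq\mathcal H_\tau$ (a face being the set of points of $\mathcal H_\tau$ at which some linear functional attains its maximum over $\mathcal H_\tau$) whose relative interior is contained in $X$. **Corollary (Hecketope correspondence).** For each $\tau\ge1$ there is a one-to-one, inclusion-reversing correspondence (an anti-isomorphism of sets partially ordered by inclusion) between the faces of the Hecketope $\mathcal H_\tau\cap X$ and the cells of the fiber $\widetilde W_\tau$. Explicitly, it sends a face $F$ to the cell $\overline\sigma_\tau(M)$ with $M=\{x\in L_0\setminus\{0\}:\psi_\tau(x)\in F\}$; this $M$ is finite with $\emptyset\ne\sigma_\tau(M)\subseteq\widetilde W_\tau$, and $F$ is the convex hull of $\{\psi_\tau(x):x\in M\}$. -/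

import Mathlib

open scoped Matrix TensorProduct Quaternion

noncomputable section

namespace Hecketope

/-- A finite product of matrix algebras over `ℝ`, `ℂ` and the Hamilton quaternions, with its
pointwise operations. Its `star` is the conjugate transpose in every factor, where "conjugate" is
the identity on `ℝ`. An isomorphism of `D ⊗ ℝ` onto such a product identifies the factors with
the completions `D_v` of `D` at the archimedean places `v` of the centre of `D`. -/
abbrev ArchAlgebra {I J K : Type*} (r : I → ℕ) (c : J → ℕ) (h : K → ℕ) : Type _ :=
  (∀ i, Matrix (Fin (r i)) (Fin (r i)) ℝ) ×
    (∀ j, Matrix (Fin (c j)) (Fin (c j)) ℂ) ×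
      (∀ k, Matrix (Fin (h k)) (Fin (h k)) ℍ[ℝ])

/-- The embedding `D → D ⊗ ℝ ≅ S` determined by an identification `θ`. -/
def archEmb {D S : Type*} [DivisionRing D] [Algebra ℚ D] [Ring S] [Algebra ℝ S]
    (θ : (ℝ ⊗[ℚ] D) ≃ₐ[ℝ] S) (d : D) : S :=
  θ ((1 : ℝ) ⊗ₜ[ℚ] d)

section

variable {D S : Type*} [DivisionRing D] [Ring S] [StarRing S] [Algebra ℝ S] {n : ℕ}

/-- A row vector over `D`, viewed as a row vector over `S`. -/
def vecEmb (ι : D → S) (x : Fin n → D) : Fin n → S := fun i => ι (x i)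

/-- A `ℤ`-lattice in `D^n`: a finitely generated subgroup that contains a `ℚ`-basis. -/
def IsZLattice [Algebra ℚ D] (L₀ : AddSubgroup (Fin n → D)) : Prop :=
  L₀.FG ∧ Submodule.span ℚ (L₀ : Set (Fin n → D)) = ⊤

/-- The image of the row vectors `L₀` in `S^n` under right multiplication by `g ∈ GL_n(S)`. -/
def latticeMul (ι : D → S) (L₀ : AddSubgroup (Fin n → D)) (g : (Matrix (Fin n) (Fin n) S)ˣ) :
    Set (Fin n → S) :=
  (fun x => vecEmb ι x ᵥ* (g : Matrix (Fin n) (Fin n) S)) '' (L₀ : Set (Fin n → D))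

/-- `γ ∈ Γ₀`: the element `γ ∈ GL_n(S)` stabilizes `L₀`, i.e. `L₀ γ = L₀`. -/
def StabilizesLattice (ι : D → S) (L₀ : AddSubgroup (Fin n → D))
    (γ : (Matrix (Fin n) (Fin n) S)ˣ) : Prop :=
  latticeMul ι L₀ γ = vecEmb ι '' (L₀ : Set (Fin n → D))

/-- `a ∈ Δ`: the element `a ∈ GL_n(S)` satisfies `L₀ a ⊆ L₀`. -/
def MemHeckeSemigroup (ι : D → S) (L₀ : AddSubgroup (Fin n → D))
    (a : (Matrix (Fin n) (Fin n) S)ˣ) : Prop :=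
  latticeMul ι L₀ a ⊆ vecEmb ι '' (L₀ : Set (Fin n → D))

/-- The sublattice `M₀ = L₀ a`, as a set of row vectors over `D`. -/
def heckeSublattice (ι : D → S) (L₀ : AddSubgroup (Fin n → D))
    (a : (Matrix (Fin n) (Fin n) S)ˣ) : Set (Fin n → D) :=
  {x | vecEmb ι x ∈ latticeMul ι L₀ a}

/-- The weight `φ(x) = φ(D x)` of a non-zero vector (the value at `0` is never used). -/
def vecWeight (φ : Projectivization D (Fin n → D) → ℝ) (x : Fin n → D) : ℝ :=
  open Classical in if hx : x = 0 then 0 else φ (Projectivization.mk D x hx)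

/-- A set of weights for `Γ₀`: a positive function on the set of lines (rank one left
`D`-submodules) of `D^n` that is invariant under the right action of `Γ₀`. -/
structure IsSetOfWeights (ι : D → S) (L₀ : AddSubgroup (Fin n → D))
    (φ : Projectivization D (Fin n → D) → ℝ) : Prop where
  pos : ∀ l, 0 < φ l
  invariant : ∀ γ : (Matrix (Fin n) (Fin n) S)ˣ, StabilizesLattice ι L₀ γ →
    ∀ x y : Fin n → D, ∀ (hx : x ≠ 0) (hy : y ≠ 0),
      vecEmb ι y = vecEmb ι x ᵥ* (γ : Matrix (Fin n) (Fin n) S) →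
        φ (Projectivization.mk D y hy) = φ (Projectivization.mk D x hx)

/-- The weight at temperament `τ`: `φ(x)` if `x ∈ M₀`, and `τ² φ(x)` if `x ∉ M₀`. -/
def temperedWeight (φ : Projectivization D (Fin n → D) → ℝ) (M₀ : Set (Fin n → D)) (τ : ℝ)
    (x : Fin n → D) : ℝ :=
  open Classical in if x ∈ M₀ then vecWeight φ x else τ ^ 2 * vecWeight φ x

/-- `Z[y] = Tr_{S/ℝ} (y Z y^*)`, which is `Tr_{S/ℝ} (∑ i, ((y g)_i)^* (y g)_i)` when
`Z = g (g^*)^t`. Here `Tr_{S/ℝ} s` is the trace of multiplication by `s`; for the product algebra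
`S` it is the sum of the traces of the factors. -/
def formValue (Z : Matrix (Fin n) (Fin n) S) (y : Fin n → S) : ℝ :=
  LinearMap.trace ℝ S (LinearMap.mulLeft ℝ ((y ᵥ* Z) ⬝ᵥ star y))

/-- The open cone `X` of positive definite Hermitian matrices. -/
def posCone (n : ℕ) (S : Type*) [Ring S] [StarRing S] [Algebra ℝ S] :
    Set (Matrix (Fin n) (Fin n) S) :=
  {Z | Z.IsHermitian ∧ ∀ y : Fin n → S, y ≠ 0 → 0 < formValue Z y}

/-- The rank one matrix `ψ(x)` with entries `x_i^* x_j`. -/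
def rankOne (ι : D → S) (x : Fin n → D) : Matrix (Fin n) (Fin n) S :=
  Matrix.of fun i j => star (ι (x i)) * ι (x j)

/-- The data of one fibre: an embedding `ι : D → S`, a lattice `L₀`, and a positive weight `w` on
the non-zero vectors of `L₀`. The weighted rank one point of `x` is `w(x) ψ(x)`. -/
def weightedPoint (ι : D → S) (w : (Fin n → D) → ℝ) (x : Fin n → D) :
    Matrix (Fin n) (Fin n) S :=
  w x • rankOne ι x

/-- The convex hull of the weighted rank one points of all non-zero lattice vectors. -/
def hull (ι : D → S) (L₀ : AddSubgroup (Fin n → D)) (w : (Fin n → D) → ℝ) :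
    Set (Matrix (Fin n) (Fin n) S) :=
  convexHull ℝ (weightedPoint ι w '' {x | x ∈ L₀ ∧ x ≠ 0})

/-- `F` is a face of the Hecketope: a non-empty proper face of the convex hull (the set of points
of the hull where some linear functional attains its maximum over the hull) whose relative
interior lies in `X`. -/
structure IsHecketopeFace [TopologicalSpace S] (ι : D → S) (L₀ : AddSubgroup (Fin n → D))
    (w : (Fin n → D) → ℝ) (F : Set (Matrix (Fin n) (Fin n) S)) : Prop where
  exposed : IsExposed ℝ (hull ι L₀ w) F
  nonempty : F.Nonempty
  proper : F ≠ hull ι L₀ w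
  interior_subset : intrinsicInterior ℝ F ⊆ posCone n S

/-- The minimal vectors of `Z`, when the weighted minimum of `Z` is `1`. -/
def minimalVectors (ι : D → S) (L₀ : AddSubgroup (Fin n → D)) (w : (Fin n → D) → ℝ)
    (Z : Matrix (Fin n) (Fin n) S) : Set (Fin n → D) :=
  {x | x ∈ L₀ ∧ x ≠ 0 ∧ w x * formValue Z (vecEmb ι x) = 1}

/-- The fibre of the well-tempered complex: the well-rounded `Z ∈ X` with weighted
arithmetic minimum `1`. -/
def wellRounded (ι : D → S) (L₀ : AddSubgroup (Fin n → D)) (w : (Fin n → D) → ℝ) :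
    Set (Matrix (Fin n) (Fin n) S) :=
  {Z | Z ∈ posCone n S ∧
    IsLeast ((fun x => w x * formValue Z (vecEmb ι x)) '' {x | x ∈ L₀ ∧ x ≠ 0}) 1 ∧
    Submodule.span S (vecEmb ι '' minimalVectors ι L₀ w Z) = ⊤}

/-- The set `σ(M)` of the `Z ∈ X` with `w(x) Z[x] = 1` for `x ∈ M` and `w(x) Z[x] > 1` for
the other non-zero vectors `x ∈ L₀`. -/
def openCell (ι : D → S) (L₀ : AddSubgroup (Fin n → D)) (w : (Fin n → D) → ℝ)
    (M : Set (Fin n → D)) : Set (Matrix (Fin n) (Fin n) S) :=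
  {Z | Z ∈ posCone n S ∧
    (∀ x ∈ M, w x * formValue Z (vecEmb ι x) = 1) ∧
    (∀ x ∈ L₀, x ≠ 0 → x ∉ M → 1 < w x * formValue Z (vecEmb ι x))}

/-- The closed convex polyhedron obtained from `σ(M)` by making the inequalities weak; it is the
closure of `σ(M)` when `σ(M)` is non-empty. -/
def closedCell (ι : D → S) (L₀ : AddSubgroup (Fin n → D)) (w : (Fin n → D) → ℝ)
    (M : Set (Fin n → D)) : Set (Matrix (Fin n) (Fin n) S) :=
  {Z | Z ∈ posCone n S ∧
    (∀ x ∈ M, w x * formValue Z (vecEmb ι x) = 1) ∧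
    (∀ x ∈ L₀, x ≠ 0 → 1 ≤ w x * formValue Z (vecEmb ι x))}

/-- `M` is the set of minimal vectors of a cell of the fibre: a finite set of non-zero vectors of
`L₀` for which `σ(M)` is non-empty and consists of points of the fibre. -/
structure IsCellIndex (ι : D → S) (L₀ : AddSubgroup (Fin n → D)) (w : (Fin n → D) → ℝ)
    (M : Set (Fin n → D)) : Prop where
  finite : M.Finite
  subset : ∀ x ∈ M, x ∈ L₀ ∧ x ≠ 0
  nonempty : (openCell ι L₀ w M).Nonempty
  well_rounded : openCell ι L₀ w M ⊆ wellRounded ι L₀ w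

/-- `C` is a (closed) cell of the fibre. -/
def IsCell (ι : D → S) (L₀ : AddSubgroup (Fin n → D)) (w : (Fin n → D) → ℝ)
    (C : Set (Matrix (Fin n) (Fin n) S)) : Prop :=
  ∃ M, IsCellIndex ι L₀ w M ∧ C = closedCell ι L₀ w M

/-- The non-zero lattice vectors whose weighted rank one point lies in `F`. -/
def faceVectors (ι : D → S) (L₀ : AddSubgroup (Fin n → D)) (w : (Fin n → D) → ℝ)
    (F : Set (Matrix (Fin n) (Fin n) S)) : Set (Fin n → D) :=
  {x | x ∈ L₀ ∧ x ≠ 0 ∧ weightedPoint ι w x ∈ F}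

end

end Hecketope

end

/-!
The functional that cuts out a face of the convex hull `H` of the points `w(x) ψ(x)` is the trace
pairing with `-Z` for a Hermitian matrix `Z`, and the pairing of `Z` with `w(x) ψ(x)` is
`w(x) Z[x]`. So the points of `H` where the functional is maximal are the convex combinations of the
`w(x) ψ(x)` for the vectors `x` at which `w(x) Z[x]` is minimal, and the correspondence sends the
face to the set of all `Z`, scaled to have minimum `1`, whose minimal vectors include these.

For a cell with index `M`, any `Z` in `σ(M)` cuts out the convex hull of `M`, and its relative
interior lies in the cone `X` because `M` spans `S^n`
(`IsAdmissible.intrinsicInterior_subset_posCone`). Conversely, `Z` is to be shown positive definite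
when it cuts out a face (`IsAdmissible.exists_posCone_of_face`). It is positive semidefinite because
multiples of lattice vectors have bounded weights (`IsAdmissible.formValue_nonneg`); its minimum is
not `0`, because the vectors of a face that meets `X` span `S^n` and the face is proper; and a
positive semidefinite form that is bounded below by a positive constant on the non-zero vectors of a
lattice is positive definite, by Dirichlet's theorem (`pos_of_integral_ge`).

All this requires that the weights are bounded, and bounded away from `0`, which is a finiteness
theorem of arithmetic: the stabilizer of the lattice has finitely many orbits on lines
(`finite_range_of_invariant`). It follows from the finiteness of class numbers, in the form that
left ideals of an order are principal up to a uniformly bounded factor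
(`exists_nsmul_mem_principal`): every lattice then has a basis adapted to a given line such that the
lattice lies between a free module and `1/m` times that module, with `m` bounded
(`exists_adapted_basis`), and only finitely many lattices do.
-/

namespace Hecketope

/-! ### Simultaneous Diophantine approximation -/

/-- Dirichlet's theorem, with a bound on the multiplier `t` that does not depend on `y`. -/
theorem exists_nsmul_near_integers {K ι : Type*} [Field K] [LinearOrder K] [IsStrictOrderedRing K]
    [FloorRing K] [Fintype ι] {q : ℕ} (hq : 0 < q) (y : ι → K) :
    ∃ t : ℕ, 0 < t ∧ t ≤ q ^ Fintype.card ι ∧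
      ∃ z : ι → ℤ, ∀ i, |(t : K) * y i - z i| < 1 / q := by
  classical
  have hq' : (0 : K) < q := by exact_mod_cast hq
  have key : ∀ s : K, (⌊(q : K) * Int.fract s⌋).toNat < q := by
    intro s
    have h1 : ⌊(q : K) * Int.fract s⌋ < q := by
      rw [Int.floor_lt]
      have := Int.fract_lt_one s
      push_cast
      nlinarith
    omega
  let f : Fin (q ^ Fintype.card ι + 1) → (ι → Fin q) := fun t i =>
    ⟨(⌊(q : K) * Int.fract ((t : ℕ) * y i)⌋).toNat, key _⟩
  obtain ⟨s, t, hst, hf⟩ := Fintype.exists_ne_map_eq_of_card_lt f (by simp)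
  wlog hlt : s < t generalizing s t
  · exact this t s hst.symm hf.symm (lt_of_le_of_ne (not_lt.mp hlt) hst.symm)
  have hlt' : (s : ℕ) < t := hlt
  refine ⟨t - s, by omega, by omega, fun i => ⌊((t : ℕ) : K) * y i⌋ - ⌊((s : ℕ) : K) * y i⌋,
    fun i => ?_⟩
  have h1 := congrArg Fin.val (congrFun hf i)
  simp only [f] at h1
  have e1 : (0 : ℤ) ≤ ⌊(q : K) * Int.fract ((s : ℕ) * y i)⌋ :=
    Int.floor_nonneg.mpr (mul_nonneg hq'.le (Int.fract_nonneg _))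
  have e2 : (0 : ℤ) ≤ ⌊(q : K) * Int.fract ((t : ℕ) * y i)⌋ :=
    Int.floor_nonneg.mpr (mul_nonneg hq'.le (Int.fract_nonneg _))
  have h2 : ⌊(q : K) * Int.fract ((t : ℕ) * y i)⌋ = ⌊(q : K) * Int.fract ((s : ℕ) * y i)⌋ := by
    omega
  have h3 := Int.abs_sub_lt_one_of_floor_eq_floor h2
  rw [← mul_sub, abs_mul, abs_of_pos hq'] at h3
  rw [lt_div_iff₀ hq', mul_comm]
  convert h3 using 3
  rw [Nat.cast_sub hlt'.le]
  push_cast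
  simp only [Int.fract]
  ring

/-! ### Finitely generated subgroups of rational vector spaces -/

section Lattice

variable {V : Type*} [AddCommGroup V]

/-- A full finitely generated subgroup of a rational vector space is the set of integral
combinations of some basis. -/
theorem exists_basis_forall_mem_iff [Module ℚ V] (L : AddSubgroup V)
    (hfg : L.FG) (hfull : ∀ x, ∃ k : ℕ, 0 < k ∧ k • x ∈ L) :
    ∃ (N : ℕ) (b : Module.Basis (Fin N) ℚ V), ∀ x, x ∈ L ↔ ∀ i, ∃ z : ℤ, b.repr x i = z := by
  have : Module.Finite ℤ L := Module.Finite.iff_addGroup_fg.mpr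
    ((AddGroup.fg_iff_addSubgroup_fg _).mpr hfg)
  have : IsAddTorsionFree V := IsAddTorsionFree.of_module_rat V
  have : Module.IsTorsionFree ℤ L := inferInstance
  let c := Module.finBasis ℤ L
  have hli : LinearIndependent ℚ (fun i => (c i : V)) := by
    rw [← LinearIndependent.iff_fractionRing (R := ℤ)]
    exact c.linearIndependent.map' L.subtype.toIntLinearMap
      (LinearMap.ker_eq_bot.mpr Subtype.val_injective)
  have hmem : ∀ x ∈ L, ∃ z : Fin (Module.finrank ℤ L) → ℤ, x = ∑ i, (z i : ℚ) • (c i : V) := by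
    intro x hx
    refine ⟨fun i => c.repr ⟨x, hx⟩ i, ?_⟩
    have := congrArg L.subtype (c.sum_repr ⟨x, hx⟩)
    simp only [map_sum, map_zsmul, AddSubgroup.subtype_apply] at this
    simpa [Int.cast_smul_eq_zsmul] using this.symm
  have hsp : ⊤ ≤ Submodule.span ℚ (Set.range fun i => (c i : V)) := by
    intro x _
    obtain ⟨k, hk, hkx⟩ := hfull x
    obtain ⟨z, hz⟩ := hmem _ hkx
    have hk' : (k : ℚ) ≠ 0 := by exact_mod_cast hk.ne'
    have : x = (k : ℚ)⁻¹ • ∑ i, (z i : ℚ) • (c i : V) := by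
      rw [← hz, ← Nat.cast_smul_eq_nsmul ℚ, inv_smul_smul₀ hk']
    rw [this]
    exact Submodule.smul_mem _ _ (Submodule.sum_mem _ fun i _ =>
      Submodule.smul_mem _ _ (Submodule.subset_span ⟨i, rfl⟩))
  refine ⟨_, Module.Basis.mk hli hsp, fun x => ⟨fun hx i => ?_, fun h => ?_⟩⟩
  · obtain ⟨z, rfl⟩ := hmem x hx
    refine ⟨z i, ?_⟩
    have : ∑ i, (z i : ℚ) • (c i : V) = ∑ i, (z i : ℚ) • (Module.Basis.mk hli hsp) i := by simp
    rw [this, Module.Basis.repr_sum_self]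
  · choose z hz using h
    rw [← (Module.Basis.mk hli hsp).sum_repr x]
    refine AddSubgroup.sum_mem _ fun i _ => ?_
    rw [hz i, Int.cast_smul_eq_zsmul, Module.Basis.mk_apply]
    exact AddSubgroup.zsmul_mem _ (c i).2 _

/-- A common denominator for the image of `L`, with respect to a full subgroup `L'`. -/
theorem exists_nsmul_map_mem {W : Type*} [AddCommGroup W] (L : AddSubgroup V) (hfg : L.FG)
    (L' : AddSubgroup W) (hfull : ∀ x, ∃ k : ℕ, 0 < k ∧ k • x ∈ L') (f : V →+ W) :
    ∃ k : ℕ, 0 < k ∧ ∀ x ∈ L, k • f x ∈ L' := by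
  obtain ⟨s, rfl⟩ := hfg
  choose k hk hkm using hfull
  refine ⟨∏ x ∈ s, k (f x), Finset.prod_pos fun _ _ => hk _, fun x hx => ?_⟩
  induction hx using AddSubgroup.closure_induction with
  | mem x hx =>
    obtain ⟨c, hc⟩ := Finset.dvd_prod_of_mem (fun x => k (f x)) hx
    rw [hc, mul_comm, mul_smul]
    exact AddSubgroup.nsmul_mem _ (hkm _) _
  | zero => simp
  | add x y _ _ hx hy => rw [map_add, smul_add]; exact add_mem hx hy
  | neg x _ hx => rw [map_neg, smul_neg]; exact neg_mem hx

theorem fg_comap_of_injective {W : Type*} [AddCommGroup W] (L : AddSubgroup V) (hfg : L.FG)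
    (f : W →+ V) (hf : Function.Injective f) (L' : AddSubgroup W) (h : ∀ x ∈ L', f x ∈ L) :
    L'.FG := by
  have : Module.Finite ℤ L := Module.Finite.iff_addGroup_fg.mpr
    ((AddGroup.fg_iff_addSubgroup_fg _).mpr hfg)
  let g : L' →+ L := (f.comp L'.subtype).codRestrict L fun x => h _ x.2
  have hg : Function.Injective g := fun x y hxy =>
    Subtype.ext (hf (congrArg Subtype.val hxy))
  have : Module.Finite ℤ L' := Module.Finite.of_injective g.toIntLinearMap hg
  exact (AddGroup.fg_iff_addSubgroup_fg _).mp (Module.Finite.iff_addGroup_fg.mp this)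

theorem finite_addSubgroups_of_nsmul_mem (A : AddSubgroup V) (hfg : A.FG) {m : ℕ} (hm : 0 < m) :
    {B : AddSubgroup A | ∀ x, m • x ∈ B}.Finite := by
  have : Module.Finite ℤ A := Module.Finite.iff_addGroup_fg.mpr
    ((AddGroup.fg_iff_addSubgroup_fg _).mpr hfg)
  let R : AddSubgroup A := (nsmulAddMonoidHom m).range
  have : AddGroup.FG A := Module.Finite.iff_addGroup_fg.mp this
  have hfin : Finite (A ⧸ R) := by
    refine AddCommGroup.finite_of_fg_isAddTorsion (G := A ⧸ R) ?_
    intro x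
    obtain ⟨x, rfl⟩ := QuotientAddGroup.mk_surjective x
    rw [isOfFinAddOrder_iff_nsmul_eq_zero]
    refine ⟨m, hm, ?_⟩
    rw [← QuotientAddGroup.mk_nsmul, QuotientAddGroup.eq_zero_iff]
    exact ⟨x, rfl⟩
  have : Finite (AddSubgroup (A ⧸ R)) := inferInstance
  refine (Set.finite_range fun C : AddSubgroup (A ⧸ R) =>
    C.comap (QuotientAddGroup.mk' R)).subset fun B hB => ?_
  refine ⟨B.map (QuotientAddGroup.mk' R), ?_⟩
  change AddSubgroup.comap _ (AddSubgroup.map _ B) = B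
  rw [AddSubgroup.comap_map_eq, QuotientAddGroup.ker_mk', sup_eq_left]
  rintro _ ⟨x, rfl⟩
  exact hB x

end Lattice

/-! ### Left ideals of orders are almost principal -/

section Order

variable {D : Type*} [DivisionRing D] [Algebra ℚ D]

theorem exists_abs_norm_lt_one {ι : Type*} [Fintype ι] (b : Module.Basis ι ℚ D) :
    ∃ q : ℕ, 0 < q ∧ ∀ c : ι → ℚ, (∀ i, |c i| < 1 / q) →
      |Algebra.norm ℚ (∑ i, c i • b i)| < 1 := by
  classical
  let B : ℚ := ∑ i, ∑ j, ∑ k, |Algebra.leftMulMatrix b (b i) j k|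
  have hB : 0 ≤ B := Finset.sum_nonneg fun i _ => Finset.sum_nonneg fun j _ =>
    Finset.sum_nonneg fun k _ => abs_nonneg _
  have hne : Nonempty ι := by
    by_contra h
    rw [not_nonempty_iff] at h
    have := b.sum_repr 1
    simp at this
  obtain ⟨q, hq⟩ := exists_nat_gt (((Fintype.card ι).factorial : ℚ) * (B + 1) + (B + 1))
  have hfac : (1 : ℚ) ≤ (Fintype.card ι).factorial := by
    exact_mod_cast Nat.succ_le_of_lt (Nat.factorial_pos _)
  have hq0 : (0 : ℚ) < q := by nlinarith
  refine ⟨q, by exact_mod_cast hq0, fun c hc => ?_⟩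
  rw [Algebra.norm_eq_matrix_det b]
  have hx1 : 1 / (q : ℚ) * (B + 1) ≤ 1 := by
    rw [one_div_mul_eq_div, div_le_one hq0]
    nlinarith
  have hx0 : 0 ≤ 1 / (q : ℚ) * (B + 1) := by positivity
  have hent : ∀ j k, AbsoluteValue.abs (Algebra.leftMulMatrix b (∑ i, c i • b i) j k)
      ≤ 1 / (q : ℚ) * (B + 1) := by
    intro j k
    simp only [map_sum, map_smul, Matrix.sum_apply, Matrix.smul_apply, AbsoluteValue.abs_apply,
      smul_eq_mul]
    calc |∑ i, c i * Algebra.leftMulMatrix b (b i) j k|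
        ≤ ∑ i, |c i * Algebra.leftMulMatrix b (b i) j k| := Finset.abs_sum_le_sum_abs _ _
      _ ≤ ∑ i, 1 / (q : ℚ) * ∑ j, ∑ k, |Algebra.leftMulMatrix b (b i) j k| := by
          refine Finset.sum_le_sum fun i _ => ?_
          rw [abs_mul]
          refine mul_le_mul (hc i).le ?_ (abs_nonneg _) (by positivity)
          refine le_trans ?_ (Finset.single_le_sum (f := fun j => ∑ k,
            |Algebra.leftMulMatrix b (b i) j k|)
            (fun j _ => Finset.sum_nonneg fun k _ => abs_nonneg _) (Finset.mem_univ j))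
          exact Finset.single_le_sum (f := fun k => |Algebra.leftMulMatrix b (b i) j k|)
            (fun k _ => abs_nonneg _) (Finset.mem_univ k)
      _ = 1 / (q : ℚ) * B := by rw [← Finset.mul_sum]
      _ ≤ _ := by gcongr; linarith
  have h := Matrix.det_le hent
  rw [AbsoluteValue.abs_apply, nsmul_eq_mul] at h
  refine h.trans_lt ?_
  have h2 : (1 / (q : ℚ) * (B + 1)) ^ Fintype.card ι ≤ 1 / (q : ℚ) * (B + 1) :=
    pow_le_of_le_one hx0 hx1 Fintype.card_ne_zero
  refine (mul_le_mul_of_nonneg_left h2 (by positivity)).trans_lt ?_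
  rw [one_div_mul_eq_div, mul_div_assoc', div_lt_one hq0]
  linarith

theorem exists_int_norm_eq {ι : Type*} [Fintype ι] (Λ : Subring D) (b : Module.Basis ι ℚ D)
    (hb : ∀ x, x ∈ Λ ↔ ∀ i, ∃ z : ℤ, b.repr x i = z) {x : D} (hx : x ∈ Λ) :
    ∃ z : ℤ, Algebra.norm ℚ x = z := by
  classical
  have hbm : ∀ i, b i ∈ Λ := fun i => (hb _).mpr fun j => by
    rw [b.repr_self, Finsupp.single_apply]
    split_ifs
    exacts [⟨1, by simp⟩, ⟨0, by simp⟩]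
  have : ∀ i j, ∃ z : ℤ, Algebra.leftMulMatrix b x i j = z := fun i j => by
    rw [Algebra.leftMulMatrix_eq_repr_mul]
    exact (hb _).mp (mul_mem hx (hbm j)) i
  choose A hA using this
  refine ⟨(Matrix.of A).det, ?_⟩
  rw [Algebra.norm_eq_matrix_det b]
  have : Algebra.leftMulMatrix b x = (Matrix.of A).map (Int.castRingHom ℚ) := by
    ext i j; simp [hA]
  rw [this, ← RingHom.mapMatrix_apply, ← RingHom.map_det]
  simp

/-- Finiteness of the class number, in the form that is needed for orbits of lines: up to the factor
`T`, which depends on the order `Λ` only, every non-zero finitely generated left ideal is principal.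
The generator `d` is an element of least norm: for `x ∈ I`, some multiple `t (x d⁻¹)` with bounded
`t` differs from an element of `Λ` by an element of norm less than `1`. -/
theorem exists_nsmul_mem_principal (Λ : Subring D)
    (hfg : Λ.toAddSubgroup.FG) (hfull : ∀ x : D, ∃ k : ℕ, 0 < k ∧ k • x ∈ Λ) :
    ∃ T : ℕ, 0 < T ∧ ∀ I : AddSubgroup D, (∀ l ∈ Λ, ∀ x ∈ I, l * x ∈ I) → I.FG → I ≠ ⊥ →
      ∃ d ∈ I, d ≠ 0 ∧ ∀ x ∈ I, ∃ l ∈ Λ, T • x = l * d := by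
  obtain ⟨N, b, hb⟩ := exists_basis_forall_mem_iff Λ.toAddSubgroup hfg hfull
  replace hb : ∀ x, x ∈ Λ ↔ ∀ i, ∃ z : ℤ, b.repr x i = z := hb
  obtain ⟨q, hq, hnorm⟩ := exists_abs_norm_lt_one b
  refine ⟨(q ^ N).factorial, Nat.factorial_pos _, fun I hI hIfg hI0 => ?_⟩
  -- After multiplication by a common denominator `k`, norms of elements of `I` are integers, so one
  -- of them is least.
  obtain ⟨k, hk, hkI⟩ := exists_nsmul_map_mem I hIfg Λ.toAddSubgroup hfull (AddMonoidHom.id D)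
  have hint : ∀ x ∈ I, ∃ z : ℕ, |Algebra.norm ℚ (k • x)| = z := fun x hx => by
    obtain ⟨z, hz⟩ := exists_int_norm_eq Λ b hb (hkI x hx)
    refine ⟨z.natAbs, ?_⟩
    rw [AddMonoidHom.id_apply] at hz
    rw [hz, Nat.cast_natAbs, Int.cast_abs]
  choose! f hf using hint
  obtain ⟨⟨d₀, hd₀⟩, hne⟩ := AddSubgroup.ne_bot_iff_exists_ne_zero.mp hI0
  have hd₀0 : d₀ ≠ 0 := fun h => hne (Subtype.ext h)
  obtain ⟨d, ⟨hdI, hd0⟩, hmin⟩ := (measure f).wf.has_min {d | d ∈ I ∧ d ≠ 0} ⟨d₀, hd₀, hd₀0⟩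
  refine ⟨d, hdI, hd0, fun x hx => ?_⟩
  obtain ⟨t, ht0, htq, z, hz⟩ := exists_nsmul_near_integers hq (fun i => b.repr (x * d⁻¹) i)
  rw [Fintype.card_fin] at htq
  let l : D := ∑ i, (z i : ℚ) • b i
  have hl : l ∈ Λ := (hb _).mpr fun i => ⟨z i, by simp only [l, b.repr_sum_self]⟩
  have hsmall : |Algebra.norm ℚ ((t : ℚ) • (x * d⁻¹) - l)| < 1 := by
    have : (t : ℚ) • (x * d⁻¹) - l = ∑ i, ((t : ℚ) * b.repr (x * d⁻¹) i - z i) • b i := by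
      simp only [sub_smul, mul_smul, Finset.sum_sub_distrib, l]
      conv_lhs => rw [← b.sum_repr (x * d⁻¹)]
      exact congrArg (· - _) (map_sum (LinearMap.lsmul ℚ D (t : ℚ)) _ _)
    rw [this]
    exact hnorm _ hz
  have heq : t • x - l * d = ((t : ℚ) • (x * d⁻¹) - l) * d := by
    rw [sub_mul, smul_mul_assoc, mul_assoc, inv_mul_cancel₀ hd0, mul_one, Nat.cast_smul_eq_nsmul]
  have hmem : t • x - l * d ∈ I := sub_mem (AddSubgroup.nsmul_mem _ hx _) (hI _ hl _ hdI)
  have hnd : 0 < |Algebra.norm ℚ (k • d)| := by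
    have hkd : k • d ≠ 0 := by
      rw [nsmul_eq_mul]
      have : CharZero D := algebraRat.charZero D
      exact mul_ne_zero (by exact_mod_cast hk.ne') hd0
    exact abs_pos.mpr ((IsUnit.mk0 _ hkd).map (Algebra.norm ℚ)).ne_zero
  have hzero : t • x - l * d = 0 := by
    by_contra h0
    refine hmin _ ⟨hmem, h0⟩ ?_
    change f _ < f _
    have : (f (t • x - l * d) : ℚ) < f d := by
      rw [← hf _ hmem, ← hf _ hdI, heq, ← mul_smul_comm, map_mul, abs_mul]
      nlinarith
    exact_mod_cast this
  obtain ⟨c, hc⟩ := Nat.dvd_factorial ht0 htq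
  refine ⟨c • l, nsmul_mem hl _, ?_⟩
  rw [hc, mul_comm, mul_smul, sub_eq_zero.mp hzero, smul_mul_assoc]

end Order

/-! ### Finiteness of the number of orbits of lines -/

section Order

universe u

theorem exists_linearMap_ne_zero_vanishing {D V : Type*} [DivisionRing D] [AddCommGroup V]
    [Module D V] {n : ℕ} (hV : Module.finrank D V = n + 1) (v : V) :
    ∃ f : V →ₗ[D] D, f ≠ 0 ∧ (n ≠ 0 → f v = 0) := by
  have : Module.Finite D V := Module.finite_of_finrank_eq_succ hV
  have : Module.Finite D V := Module.finite_of_finrank_eq_succ hV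
  obtain ⟨p, hp, hvp⟩ : ∃ p : Submodule D V, Module.finrank D p ≤ n ∧ (n ≠ 0 → v ∈ p) := by
    by_cases hn : n = 0
    · exact ⟨⊥, by simp, fun h => absurd hn h⟩
    · have := finrank_span_le_card (R := D) ({v} : Set V)
      simp only [Set.toFinset_singleton, Finset.card_singleton] at this
      exact ⟨Submodule.span D {v}, by omega, fun _ => Submodule.mem_span_singleton_self v⟩
  have hp' : p < ⊤ := lt_top_iff_ne_top.mpr fun htop => by
    rw [htop, finrank_top, hV] at hp
    omega
  obtain ⟨f, hf, hpf⟩ := Submodule.exists_le_ker_of_lt_top p hp'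
  exact ⟨f, hf, fun hn => hpf (hvp hn)⟩

variable {D : Type*} [DivisionRing D] [Algebra ℚ D]

/-- A lattice `L` over the order `Λ` lies between a free `Λ`-module and `1/m` times that module,
where `m` depends on `Λ` and the dimension only and the last vector of the basis can be chosen on a
given line `D v`. The premise `n = 0 → Subsingleton V` is there because `finrank` is also `0` in
infinite dimension. -/
theorem exists_adapted_basis (Λ : Subring D)
    (hfg : Λ.toAddSubgroup.FG) (hfull : ∀ x : D, ∃ k : ℕ, 0 < k ∧ k • x ∈ Λ) (n : ℕ) :
    ∃ m : ℕ, 0 < m ∧ ∀ (V : Type u) [AddCommGroup V] [Module D V] (L : AddSubgroup V) (v : V),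
      Module.finrank D V = n → (n = 0 → Subsingleton V) →
      L.FG → (∀ x : V, ∃ k : ℕ, 0 < k ∧ k • x ∈ L) → (∀ l ∈ Λ, ∀ x ∈ L, l • x ∈ L) →
      ∃ b : Module.Basis (Fin n) D V, (∀ i, b i ∈ L) ∧
        (∀ i : Fin n, (i : ℕ) + 1 = n → ∃ c : D, v = c • b i) ∧
        ∀ x : V, x ∈ L → ∃ a : Fin n → D, (∀ i, a i ∈ Λ) ∧ m • x = ∑ i, a i • b i := by
  obtain ⟨T, hT, hTI⟩ := exists_nsmul_mem_principal Λ hfg hfull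
  induction n with
  | zero =>
    refine ⟨1, one_pos, fun V _ _ L v _ hs _ _ _ => ?_⟩
    have := hs rfl
    exact ⟨Module.Basis.empty V, fun i => i.elim0, fun i => i.elim0,
      fun x _ => ⟨fun i => i.elim0, fun i => i.elim0, Subsingleton.elim _ _⟩⟩
  | succ n ih =>
    obtain ⟨m, hm, ih⟩ := ih
    refine ⟨m * T, Nat.mul_pos hm hT, fun V _ _ L v hV _ hLfg hLfull hLΛ => ?_⟩
    have : Module.Finite D V := Module.finite_of_finrank_eq_succ hV
    -- The kernel of `f` is treated by induction; the image of the new basis vector `y` generates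
    -- `f(L)` up to the factor `T`.
    obtain ⟨f, hf0, hfv⟩ := exists_linearMap_ne_zero_vanishing hV v
    let N : Submodule D V := LinearMap.ker f
    have hsurj : Function.Surjective f := LinearMap.surjective hf0
    have hN : Module.finrank D N = n := by
      have := LinearMap.finrank_range_add_finrank_ker f
      rw [LinearMap.range_eq_top.mpr hsurj, finrank_top, Module.finrank_self, hV] at this
      change Module.finrank D (LinearMap.ker f) = n
      omega
    let LN : AddSubgroup N := L.comap N.subtype.toAddMonoidHom
    let v' : N := if hn : n = 0 then 0 else ⟨v, hfv hn⟩
    obtain ⟨b, hbL, hbv, hb⟩ := ih N LN v' hN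
      (fun h => Module.finrank_zero_iff.mp (hN.trans h))
      (fg_comap_of_injective L hLfg N.subtype.toAddMonoidHom Subtype.val_injective LN
        fun x hx => hx)
      (fun x => (hLfull x).imp fun k hk => ⟨hk.1, hk.2⟩)
      (fun l hl x hx => hLΛ l hl x hx)
    obtain ⟨d, hdI, hd0, hd⟩ := hTI (L.map f.toAddMonoidHom)
      (by
        rintro l hl _ ⟨x, hx, rfl⟩
        exact ⟨l • x, hLΛ l hl x hx, by simp⟩)
      (by
        obtain ⟨s, rfl⟩ := hLfg
        classical
        exact ⟨s.image f, by rw [AddMonoidHom.map_closure]; simp⟩)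
      (by
        obtain ⟨x, hx⟩ := hsurj 1
        obtain ⟨k, hk, hkx⟩ := hLfull x
        intro hbot
        have h1 : f (k • x) ∈ L.map f.toAddMonoidHom := ⟨k • x, hkx, rfl⟩
        rw [hbot, AddSubgroup.mem_bot, map_nsmul, hx, nsmul_one] at h1
        have : CharZero D := algebraRat.charZero D
        exact hk.ne' (by exact_mod_cast h1))
    obtain ⟨y, hyL, rfl⟩ := hdI
    replace hd0 : f y ≠ 0 := hd0
    let B := Module.Basis.mkFinCons y b
      (by
        intro c x hx hcx
        have := congrArg f hcx
        rw [map_add, map_smul, LinearMap.mem_ker.mp hx, add_zero, map_zero, smul_eq_mul] at this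
        exact (mul_eq_zero.mp this).resolve_right hd0)
      (by
        intro z
        refine ⟨-(f z * (f y)⁻¹), LinearMap.mem_ker.mpr ?_⟩
        rw [map_add, map_smul, smul_eq_mul, neg_mul, mul_assoc, inv_mul_cancel₀ hd0, mul_one,
          add_neg_cancel])
    have hB : (B : Fin (n + 1) → V) = Fin.cons y ((↑) ∘ b) := Module.Basis.coe_mkFinCons _ _ _ _
    refine ⟨B, fun i => ?_, fun i hi => ?_, fun x hx => ?_⟩
    · rw [hB]
      refine Fin.cases hyL (fun i => ?_) i
      exact hbL i
    · rw [hB]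
      by_cases hn : n = 0
      · subst hn
        obtain rfl : i = 0 := Fin.ext (by omega)
        refine ⟨f v * (f y)⁻¹, ?_⟩
        rw [Fin.cons_zero, ← sub_eq_zero]
        have hk : v - (f v * (f y)⁻¹) • y ∈ N := LinearMap.mem_ker.mpr (by
          rw [map_sub, map_smul, smul_eq_mul, mul_assoc, inv_mul_cancel₀ hd0, mul_one, sub_self])
        have : Subsingleton N := Module.finrank_zero_iff.mp hN
        exact congrArg Subtype.val (Subsingleton.elim (⟨_, hk⟩ : N) 0)
      · obtain ⟨j, rfl⟩ : ∃ j : Fin n, i = j.succ := Fin.exists_succ_eq.mpr (fun h => by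
          rw [h] at hi; simp at hi; omega) |>.imp fun j hj => hj.symm
        obtain ⟨c, hc⟩ := hbv j (by simpa using hi)
        refine ⟨c, ?_⟩
        have := congrArg Subtype.val hc
        simpa [v', hn] using this
    · obtain ⟨l, hl, hlx⟩ := hd (f x) ⟨x, hx, rfl⟩
      replace hlx : T • f x = l * f y := hlx
      have hk : T • x - l • y ∈ N := LinearMap.mem_ker.mpr (by
        rw [map_sub, map_nsmul, map_smul, hlx, smul_eq_mul, sub_self])
      obtain ⟨a, haΛ, ha⟩ := hb ⟨_, hk⟩
        (show T • x - l • y ∈ L from sub_mem (AddSubgroup.nsmul_mem _ hx _) (hLΛ l hl y hyL))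
      refine ⟨Fin.cons (m • l) a, fun i => ?_, ?_⟩
      · refine Fin.cases (nsmul_mem hl _) (fun i => ?_) i
        exact haΛ i
      · have := congrArg Subtype.val ha
        rw [hB, Fin.sum_univ_succ]
        simp only [Fin.cons_zero, Fin.cons_succ, Function.comp_apply]
        simp only [Submodule.coe_smul_of_tower, Submodule.coe_sum] at this
        rw [← this, smul_sub, mul_smul, smul_assoc, add_sub_cancel]

/-- The left order of a subgroup `L` of a left `D`-module: all `d` with `d L ⊆ L`. -/
def leftOrder {V : Type*} [AddCommGroup V] [Module D V] (L : AddSubgroup V) : Subring D where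
  carrier := {d | ∀ x ∈ L, d • x ∈ L}
  mul_mem' {a b} ha hb x hx := by rw [mul_smul]; exact ha _ (hb _ hx)
  one_mem' x hx := by rwa [one_smul]
  add_mem' {a b} ha hb x hx := by rw [add_smul]; exact add_mem (ha _ hx) (hb _ hx)
  zero_mem' x _ := by rw [zero_smul]; exact zero_mem _
  neg_mem' {a} ha x hx := by rw [neg_smul]; exact neg_mem (ha _ hx)

/-- A function on the lines of `D^n` that is invariant under the stabilizer of a lattice `L` takes
finitely many values. In coordinates with respect to a basis adapted to `L` and a line `l`, the
lattice `L` becomes one of the finitely many groups between `Λ^n` and `(1/m) Λ^n`, and when two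
lines give the same group, the change of basis stabilizes `L` and maps one line to the other. -/
theorem finite_range_of_invariant {n : ℕ} (L : AddSubgroup (Fin n → D)) (hLfg : L.FG)
    (hLfull : ∀ x, ∃ k : ℕ, 0 < k ∧ k • x ∈ L) {α : Type*} [Nonempty α]
    (φ : Projectivization D (Fin n → D) → α)
    (hφ : ∀ g : (Fin n → D) ≃ₗ[D] (Fin n → D), (∀ x, g x ∈ L ↔ x ∈ L) →
      ∀ x y (hx : x ≠ 0) (hy : y ≠ 0), y = g x →
        φ (Projectivization.mk D y hy) = φ (Projectivization.mk D x hx)) :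
    (Set.range φ).Finite := by
  cases n with
  | zero =>
    have : IsEmpty (Projectivization D (Fin 0 → D)) :=
      ⟨fun l => l.rep_nonzero (Subsingleton.elim _ _)⟩
    rw [Set.range_eq_empty]
    exact Set.finite_empty
  | succ n =>
  let Λ : Subring D := leftOrder L
  have hcz : CharZero D := algebraRat.charZero D
  have hfull : ∀ d : D, ∃ k : ℕ, 0 < k ∧ k • d ∈ Λ := fun d => by
    obtain ⟨k, hk, h⟩ := exists_nsmul_map_mem L hLfg L hLfull
      (DistribSMul.toAddMonoidHom (Fin (n + 1) → D) d)
    exact ⟨k, hk, fun x hx => by rw [smul_assoc]; exact h x hx⟩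
  have hfg : Λ.toAddSubgroup.FG := by
    obtain ⟨k, hk, hkx⟩ := hLfull (fun _ => 1)
    refine fg_comap_of_injective L hLfg
      ((smulAddHom D (Fin (n + 1) → D)).flip (k • fun _ => 1)) ?_ _ fun x hx => hx _ hkx
    intro x y hxy
    have := congrFun hxy 0
    simpa [hk.ne'] using this
  obtain ⟨m, hm, H⟩ := exists_adapted_basis Λ hfg hfull (n + 1)
  have H' := fun v => H (Fin (n + 1) → D) L v (Module.finrank_fin_fun D) (by simp) hLfg hLfull
    (fun l hl x hx => hl x hx)
  choose b hbL hbv hb using H'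
  let A : AddSubgroup (Fin (n + 1) → D) :=
    AddSubgroup.pi Set.univ fun _ => Λ.toAddSubgroup
  let e := fun v => (b v).equivFun.symm
  have hA : ∀ {x : Fin (n + 1) → D}, x ∈ A ↔ ∀ i, x i ∈ Λ := by
    simp [A, AddSubgroup.mem_pi]
  have hAe : ∀ v, ∀ x ∈ A, e v x ∈ L := fun v x hx => by
    simp only [e, Module.Basis.equivFun_symm_apply]
    exact sum_mem fun i _ => hA.mp hx i _ (hbL v i)
  have hAfg : A.FG := fg_comap_of_injective L hLfg ((e 0).toLinearMap.toAddMonoidHom)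
    (e 0).injective A (hAe 0)
  -- `B v` is `m` times the lattice `L` in the coordinates of `b v`; it contains `m A`.
  let B : (Fin (n + 1) → D) → AddSubgroup A := fun v =>
    ((L.comap (e v).toLinearMap.toAddMonoidHom).map (nsmulAddMonoidHom m)).comap A.subtype
  have hBmem : ∀ v, B v ∈ {B : AddSubgroup A | ∀ x, m • x ∈ B} := fun v x =>
    ⟨x, hAe v _ x.2, rfl⟩
  have hB : ∀ v x, e v x ∈ L ↔ ∃ h : m • x ∈ A, (⟨m • x, h⟩ : A) ∈ B v := by
    refine fun v x => ⟨fun hx => ⟨?_, x, hx, rfl⟩, ?_⟩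
    · obtain ⟨a, haΛ, ha⟩ := hb v _ hx
      have : m • x = a := (e v).injective (by
        rw [map_nsmul, ha]; simp only [e, Module.Basis.equivFun_symm_apply])
      rw [this]
      exact hA.mpr haΛ
    · rintro ⟨_, x', hx', hxx'⟩
      have : IsAddTorsionFree (Fin (n + 1) → D) := IsAddTorsionFree.of_module_rat _
      obtain rfl : x' = x := nsmul_right_injective hm.ne' hxx'
      exact hx'
  have hdep : Function.FactorsThrough φ fun l => B l.rep := by
    intro l l' hll
    have key : ∀ l : Projectivization D (Fin (n + 1) → D),
        φ l = φ (Projectivization.mk D (b l.rep (Fin.last n)) ((b l.rep).ne_zero _)) := by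
      intro l
      conv_lhs => rw [← l.mk_rep]
      congr 1
      obtain ⟨c, hc⟩ := hbv l.rep (Fin.last n) (by simp)
      rw [Projectivization.mk_eq_mk_iff']
      exact ⟨c, hc.symm⟩
    rw [key l, key l']
    symm
    refine hφ ((e l.rep).symm.trans (e l'.rep)) (fun x => ?_) _ _ _ _ ?_
    · obtain ⟨x, rfl⟩ := (e l.rep).surjective x
      simp only [LinearEquiv.trans_apply, LinearEquiv.symm_apply_apply]
      rw [hB, hB]
      simp only at hll
      rw [hll]
    · simp [e, Finsupp.single_apply, ite_smul]
  obtain ⟨g, hg⟩ := (Function.factorsThrough_iff φ).mp hdep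
  refine ((finite_addSubgroups_of_nsmul_mem A hAfg hm).image g).subset ?_
  rintro _ ⟨l, rfl⟩
  exact ⟨_, hBmem l.rep, (congrFun hg l).symm⟩

end Order

/-! ### Real bilinear forms on a lattice -/

section BilinearForms

variable {V : Type*} [AddCommGroup V] [Module ℝ V]

theorem exists_eq_apply_of_nondegenerate [FiniteDimensional ℝ V] (B : LinearMap.BilinForm ℝ V)
    (hB : ∀ x, x ≠ 0 → ∃ y, B x y ≠ 0) (l : V →ₗ[ℝ] ℝ) : ∃ x, B x = l := by
  have hinj : Function.Injective B := (injective_iff_map_eq_zero B).mpr fun x hx => by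
    by_contra h0
    obtain ⟨y, hy⟩ := hB x h0
    exact hy (by rw [hx, LinearMap.zero_apply])
  exact (LinearMap.injective_iff_surjective_of_finrank_eq_finrank
    (Subspace.dual_finrank_eq (K := ℝ) (V := V)).symm).mp hinj l

/-- `Tr (T T')` is the squared Hilbert–Schmidt norm of `T'` when `T` is adjoint to `T'`. -/
theorem trace_pos_of_adjoint [FiniteDimensional ℝ V] (B : LinearMap.BilinForm ℝ V)
    (hsymm : ∀ x y, B x y = B y x) (hpos : ∀ x, x ≠ 0 → 0 < B x x)
    (T T' : V →ₗ[ℝ] V) (hadj : ∀ x y, B (T x) y = B x (T' y)) :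
    LinearMap.trace ℝ V T' = LinearMap.trace ℝ V T ∧
      (T' ≠ 0 → 0 < LinearMap.trace ℝ V (T * T')) := by
  have hnn : ∀ x, 0 ≤ B x x := fun x => by
    rcases eq_or_ne x 0 with rfl | hx
    · simp
    · exact (hpos x hx).le
  let core : InnerProductSpace.Core ℝ V :=
    { inner := fun x y => B x y
      conj_inner_symm := fun x y => by simpa using hsymm y x
      re_inner_nonneg := fun x => by simpa using hnn x
      add_left := fun x y z => by simp
      smul_left := fun x y r => by simp
      definite := fun x hx => by
        by_contra h
        exact (hpos x h).ne' hx }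
  let nacg : NormedAddCommGroup V := core.toNormedAddCommGroup
  let ips : InnerProductSpace ℝ V := InnerProductSpace.ofCore core.toCore
  have hin : ∀ x y : V, inner ℝ x y = B x y := fun _ _ => rfl
  let b := stdOrthonormalBasis ℝ V
  constructor
  · rw [LinearMap.trace_eq_sum_inner T' b, LinearMap.trace_eq_sum_inner T b]
    refine Finset.sum_congr rfl fun i _ => ?_
    rw [hin, hin, ← hadj, hsymm]
  · intro hT
    rw [LinearMap.trace_eq_sum_inner _ b]
    have hterm : ∀ i, inner ℝ (b i) ((T * T') (b i)) = B (T' (b i)) (T' (b i)) := fun i => by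
      rw [hin, Module.End.mul_apply, hsymm, hadj]
    simp only [hterm]
    obtain ⟨i, hi⟩ : ∃ i, T' (b i) ≠ 0 := by
      by_contra! h
      exact hT (b.toBasis.ext fun i => by simpa using h i)
    exact Finset.sum_pos' (fun i _ => hnn _) ⟨i, Finset.mem_univ i, hpos _ hi⟩

variable {ι : Type*} [Fintype ι] (e : Module.Basis ι ℝ V) (B : LinearMap.BilinForm ℝ V)

theorem abs_apply_sum_le (y : V) {δ : ℝ} {d : ι → ℝ} (hd : ∀ i, |d i| ≤ δ) :
    |B y (∑ i, d i • e i)| ≤ δ * ∑ i, |B y (e i)| := by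
  rw [map_sum, Finset.mul_sum]
  refine (Finset.abs_sum_le_sum_abs _ _).trans (Finset.sum_le_sum fun i _ => ?_)
  rw [map_smul, smul_eq_mul, abs_mul]
  exact mul_le_mul_of_nonneg_right (hd i) (abs_nonneg _)

theorem abs_apply_sum_self_le {δ : ℝ} (hδ : 0 ≤ δ) {d : ι → ℝ} (hd : ∀ i, |d i| ≤ δ) :
    |B (∑ i, d i • e i) (∑ i, d i • e i)| ≤ δ * (δ * ∑ i, ∑ j, |B (e j) (e i)|) := by
  refine (abs_apply_sum_le e B _ hd).trans (mul_le_mul_of_nonneg_left ?_ hδ)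
  rw [Finset.mul_sum]
  refine Finset.sum_le_sum fun i _ => ?_
  have := abs_apply_sum_le e B.flip (e i) hd
  simpa only [LinearMap.BilinForm.flip_apply] using this

/-- A positive definite form takes values `≤ C` at finitely many lattice points: by the
Cauchy–Schwarz inequality its values bound all coordinates. -/
theorem finite_integral_le (hsymm : ∀ x y, B x y = B y x) (hpos : ∀ x, x ≠ 0 → 0 < B x x)
    (C : ℝ) :
    {z : ι → ℤ | B (∑ i, (z i : ℝ) • e i) (∑ i, (z i : ℝ) • e i) ≤ C}.Finite := by
  classical
  have : FiniteDimensional ℝ V := e.finiteDimensional_of_finite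
  have hnn : ∀ x, 0 ≤ B x x := fun x => by
    rcases eq_or_ne x 0 with rfl | hx
    · simp
    · exact (hpos x hx).le
  choose u hu using fun i => exists_eq_apply_of_nondegenerate B
    (fun x hx => ⟨x, (hpos x hx).ne'⟩) (e.coord i)
  refine (Set.finite_Icc (fun i => -⌈B (u i) (u i) * C⌉) (fun i => ⌈B (u i) (u i) * C⌉)).subset
    fun z hz => ?_
  have key : ∀ i, |z i| ≤ ⌈B (u i) (u i) * C⌉ := by
    intro i
    have h1 := LinearMap.BilinForm.apply_sq_le_of_symm B hnn ⟨hsymm⟩ (u i)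
      (∑ i, (z i : ℝ) • e i)
    have h0 : B (u i) (∑ i, (z i : ℝ) • e i) = z i := by
      rw [hu, e.coord_apply, e.repr_sum_self]
    rw [h0] at h1
    have h2 : ((z i : ℝ)) ^ 2 ≤ B (u i) (u i) * C :=
      h1.trans (mul_le_mul_of_nonneg_left hz (hnn _))
    have h3 : (z i) ^ 2 ≤ ⌈B (u i) (u i) * C⌉ := by
      have := h2.trans (Int.le_ceil _)
      exact_mod_cast this
    refine le_trans ?_ h3
    rw [← sq_abs]
    rcases eq_or_ne (z i) 0 with h | h
    · simp [h]
    · have := Int.one_le_abs h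
      nlinarith
  exact ⟨fun i => (abs_le.mp (key i)).1, fun i => (abs_le.mp (key i)).2⟩

/-- A form that is non-negative on a lattice is positive semidefinite, since every vector has
multiples that are close to lattice points. -/
theorem nonneg_of_integral_nonneg (hsymm : ∀ x y, B x y = B y x)
    (h : ∀ z : ι → ℤ, 0 ≤ B (∑ i, (z i : ℝ) • e i) (∑ i, (z i : ℝ) • e i)) (y : V) :
    0 ≤ B y y := by
  by_contra! hy
  set K : ℝ := 2 * ∑ i, |B y (e i)| + ∑ i, ∑ j, |B (e j) (e i)| with hK
  have hK1 : 0 ≤ ∑ i, |B y (e i)| := Finset.sum_nonneg fun _ _ => abs_nonneg _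
  have hK2 : 0 ≤ ∑ i, ∑ j, |B (e j) (e i)| :=
    Finset.sum_nonneg fun _ _ => Finset.sum_nonneg fun _ _ => abs_nonneg _
  obtain ⟨q, hq⟩ := exists_nat_gt (max 1 (K / -B y y))
  have hq1 : (1 : ℝ) < q := (le_max_left _ _).trans_lt hq
  have hqK : K < q * -B y y := (div_lt_iff₀ (by linarith)).mp ((le_max_right _ _).trans_lt hq)
  obtain ⟨t, ht, -, z, hz⟩ := exists_nsmul_near_integers (q := q)
    (by exact_mod_cast zero_lt_one.trans hq1) (fun i => e.repr y i)
  have ht1 : (1 : ℝ) ≤ t := by exact_mod_cast ht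
  set d : V := ∑ i, ((t : ℝ) * e.repr y i - z i) • e i with hd
  have hv : ∑ i, (z i : ℝ) • e i = (t : ℝ) • y - d := by
    simp only [hd, sub_smul, mul_smul, Finset.sum_sub_distrib]
    rw [← Finset.smul_sum, e.sum_repr]
    abel
  have h0 := h z
  rw [hv] at h0
  simp only [map_sub, map_smul, LinearMap.sub_apply, LinearMap.smul_apply, smul_eq_mul] at h0
  rw [hsymm d y] at h0
  have h1 := abs_le.mp (abs_apply_sum_le e B y fun i => (hz i).le)
  have h2 := abs_le.mp (abs_apply_sum_self_le e B (by positivity) fun i => (hz i).le)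
  rw [← hd] at h1 h2
  have hqi : 1 / (q : ℝ) ≤ 1 := by rw [div_le_one (by linarith)]; exact hq1.le
  have hqp : 0 < 1 / (q : ℝ) := by positivity
  have h3 : 1 / (q : ℝ) * (1 / (q : ℝ) * ∑ i, ∑ j, |B (e j) (e i)|) ≤
      t * (t * (1 / (q : ℝ) * ∑ i, ∑ j, |B (e j) (e i)|)) := by
    have : 0 ≤ 1 / (q : ℝ) * ∑ i, ∑ j, |B (e j) (e i)| := by positivity
    nlinarith [mul_le_mul ht1 ht1 zero_le_one (by linarith)]
  have h4 : (t : ℝ) * (1 / (q : ℝ) * ∑ i, |B y (e i)|) ≤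
      t * (t * (1 / (q : ℝ) * ∑ i, |B y (e i)|)) := by
    have : 0 ≤ t * (1 / (q : ℝ) * ∑ i, |B y (e i)|) := by positivity
    nlinarith
  have h5 : 0 ≤ (t * t : ℝ) * (B y y + 1 / (q : ℝ) * K) := by
    rw [hK]
    nlinarith
  have h6 : 1 / (q : ℝ) * K < -B y y := by
    rw [one_div_mul_eq_div, div_lt_iff₀ (by linarith)]
    linarith
  exact h5.not_gt (mul_neg_of_pos_of_neg (by positivity) (by linarith))

/-- A form that is bounded below by a positive constant on the non-zero vectors of a lattice is
positive definite: the multiples of an isotropic vector would come close to non-zero lattice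
points. -/
theorem pos_of_integral_ge (hsymm : ∀ x y, B x y = B y x) {δ : ℝ} (hδ : 0 < δ)
    (h : ∀ z : ι → ℤ, z ≠ 0 → δ ≤ B (∑ i, (z i : ℝ) • e i) (∑ i, (z i : ℝ) • e i))
    (y : V) (hy : y ≠ 0) : 0 < B y y := by
  have hnn := nonneg_of_integral_nonneg e B hsymm fun z => by
    rcases eq_or_ne z 0 with rfl | hz
    · simp
    · exact hδ.le.trans (h z hz)
  refine lt_of_le_of_ne (hnn y) fun hy0 => ?_
  have hyv : ∀ v, B y v = 0 := fun v => by
    have := LinearMap.BilinForm.apply_sq_le_of_symm B hnn ⟨hsymm⟩ y v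
    rw [← hy0, zero_mul] at this
    exact pow_eq_zero_iff two_ne_zero |>.mp (le_antisymm this (sq_nonneg _))
  obtain ⟨i₀, hi₀⟩ : ∃ i, e.repr y i ≠ 0 := by
    by_contra! h0
    exact hy (e.ext_elem fun i => by simpa using h0 i)
  set Q : ℝ := ∑ i, ∑ j, |B (e j) (e i)| with hQ
  have hQ0 : 0 ≤ Q := Finset.sum_nonneg fun _ _ => Finset.sum_nonneg fun _ _ => abs_nonneg _
  obtain ⟨q, hq⟩ := exists_nat_gt (max 1 (Q / δ))
  have hq1 : (1 : ℝ) < q := (le_max_left _ _).trans_lt hq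
  have hqQ : Q < q * δ := (div_lt_iff₀ hδ).mp ((le_max_right _ _).trans_lt hq)
  -- Scaled so that one coordinate is `2`, `y` has no multiple `t y`, `t ≥ 1`, close to `0`.
  set s : ℝ := 2 / e.repr y i₀ with hs
  obtain ⟨t, ht, -, z, hz⟩ := exists_nsmul_near_integers (q := q)
    (by exact_mod_cast zero_lt_one.trans hq1) (fun i => s * e.repr y i)
  have ht1 : (1 : ℝ) ≤ t := by exact_mod_cast ht
  have hqi : 1 / (q : ℝ) ≤ 1 := by rw [div_le_one (by linarith)]; exact hq1.le
  have hz0 : z ≠ 0 := by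
    rintro rfl
    have := (hz i₀).trans_le hqi
    rw [hs, div_mul_cancel₀ _ hi₀, Pi.zero_apply, Int.cast_zero, sub_zero,
      abs_of_nonneg (by linarith)] at this
    linarith
  set d : V := ∑ i, ((t : ℝ) * (s * e.repr y i) - z i) • e i with hd
  have hv : ∑ i, (z i : ℝ) • e i = ((t : ℝ) * s) • y - d := by
    simp only [hd, sub_smul, ← mul_assoc, Finset.sum_sub_distrib]
    simp only [mul_smul _ (e.repr y _)]
    rw [← Finset.smul_sum, e.sum_repr]
    abel
  have h0 := h z hz0
  rw [hv] at h0
  simp only [map_sub, map_smul, LinearMap.sub_apply, LinearMap.smul_apply, smul_eq_mul,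
    hsymm d y, hyv] at h0
  have h2 := abs_le.mp (abs_apply_sum_self_le e B (by positivity) fun i => (hz i).le)
  rw [← hd] at h2
  have h3 : 1 / (q : ℝ) * (1 / (q : ℝ) * Q) ≤ 1 / (q : ℝ) * Q :=
    mul_le_of_le_one_left (by positivity) hqi
  have h6 : 1 / (q : ℝ) * Q < δ := by
    rw [one_div_mul_eq_div, div_lt_iff₀ (by linarith)]
    linarith
  linarith

end BilinearForms

/-! ### The trace form of an algebra with involution -/

section Trace

variable {S : Type*} [Ring S] [Algebra ℝ S]

/-- The trace `Tr_{S/ℝ}` of multiplication by an element of the algebra `S`. -/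
noncomputable def algTrace (S : Type*) [Ring S] [Algebra ℝ S] : S →ₗ[ℝ] ℝ :=
  LinearMap.trace ℝ S ∘ₗ LinearMap.mul ℝ S

theorem algTrace_mul_comm (s t : S) : algTrace S (s * t) = algTrace S (t * s) := by
  change LinearMap.trace ℝ S (LinearMap.mulLeft ℝ (s * t)) =
    LinearMap.trace ℝ S (LinearMap.mulLeft ℝ (t * s))
  rw [LinearMap.mulLeft_mul, LinearMap.mulLeft_mul, ← Module.End.mul_eq_comp,
    ← Module.End.mul_eq_comp, LinearMap.trace_mul_comm]

/-- The involution of `S` preserves the trace, and `Tr (s s^*) > 0` for `s ≠ 0`. -/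
structure IsPositiveInvolution (S : Type*) [Ring S] [StarRing S] [Algebra ℝ S] : Prop where
  trace_star : ∀ s : S, algTrace S (star s) = algTrace S s
  trace_mul_star_pos : ∀ s : S, s ≠ 0 → 0 < algTrace S (s * star s)

variable [StarRing S] [StarModule ℝ S]

/-- For the inner product `ρ (s^* t)`, left multiplications by `s` and by `s^*` are adjoint, so
positivity of any functional `ρ` passes to the trace. -/
theorem isPositiveInvolution_of_functional [FiniteDimensional ℝ S] (ρ : S →ₗ[ℝ] ℝ)
    (hstar : ∀ s, ρ (star s) = ρ s) (hpos : ∀ s, s ≠ 0 → 0 < ρ (star s * s)) :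
    IsPositiveInvolution S := by
  let B : LinearMap.BilinForm ℝ S := LinearMap.mk₂ ℝ (fun s t => ρ (star s * t))
    (by intros; rw [star_add, add_mul, map_add])
    (by intros; rw [star_smul, star_trivial, smul_mul_assoc, map_smul])
    (by intros; rw [mul_add, map_add])
    (by intros; rw [mul_smul_comm, map_smul])
  have hB : ∀ s t, B s t = ρ (star s * t) := fun _ _ => rfl
  have key := fun s : S => trace_pos_of_adjoint B
    (fun s t => by rw [hB, hB, ← hstar, star_mul, star_star]) hpos
    (LinearMap.mulLeft ℝ s) (LinearMap.mulLeft ℝ (star s))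
    (fun x y => by
      rw [hB, hB, LinearMap.mulLeft_apply, LinearMap.mulLeft_apply, star_mul, mul_assoc])
  refine ⟨fun s => (key s).1, fun s hs => ?_⟩
  have h := (key s).2 fun h0 => hs (by
    have := LinearMap.congr_fun h0 1
    rw [LinearMap.mulLeft_apply, mul_one, LinearMap.zero_apply] at this
    exact star_eq_zero.mp this)
  rwa [Module.End.mul_eq_comp, ← LinearMap.mulLeft_mul] at h

end Trace

/-! ### Hermitian matrices and rank one points -/

section RankOne

variable {S : Type*} [Ring S] [StarRing S] {n : ℕ}

/-- The rank one matrix with entries `y_i^* y_j`, for a row vector `y` over `S`; `rankOne ι x` is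
this matrix for the image of `x`. -/
def rankOneOf (y : Fin n → S) : Matrix (Fin n) (Fin n) S :=
  Matrix.of fun i j => star (y i) * y j

theorem isHermitian_rankOneOf (y : Fin n → S) : (rankOneOf y).IsHermitian := by
  ext i j
  simp [rankOneOf, Matrix.conjTranspose_apply]

theorem orthogonal_of_span {s : Set (Fin n → S)} (hs : Submodule.span S s = ⊤)
    {y : Fin n → S} (hy : ∀ x ∈ s, y ⬝ᵥ star x = 0) (x : Fin n → S) : y ⬝ᵥ star x = 0 := by
  have hx : x ∈ Submodule.span S s := hs ▸ Submodule.mem_top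
  induction hx using Submodule.span_induction with
  | mem x hx => exact hy x hx
  | zero => simp
  | add x x' _ _ h h' => rw [star_add, dotProduct_add, h, h', add_zero]
  | smul t x _ h =>
    have : y ⬝ᵥ star (t • x) = (y ⬝ᵥ star x) * star t := by
      simp [dotProduct, Finset.sum_mul, mul_assoc]
    rw [this, h, zero_mul]

end RankOne

section Forms

variable {S : Type*} [Ring S] [Algebra ℝ S] {n : ℕ}

/-- The trace pairing `Tr (A B)` of matrices over `S`. Its value at `Z` and the rank one matrix of
`y` is `Z[y]`. -/
noncomputable def pairing (A : Matrix (Fin n) (Fin n) S) : Matrix (Fin n) (Fin n) S →ₗ[ℝ] ℝ :=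
  algTrace S ∘ₗ Matrix.traceLinearMap (Fin n) ℝ S ∘ₗ LinearMap.mulLeft ℝ A

theorem pairing_apply (A B : Matrix (Fin n) (Fin n) S) :
    pairing A B = ∑ i, ∑ j, algTrace S (A i j * B j i) := by
  simp [pairing, Matrix.trace, Matrix.mul_apply, map_sum]

theorem pairing_comm (A B : Matrix (Fin n) (Fin n) S) : pairing A B = pairing B A := by
  rw [pairing_apply, pairing_apply, Finset.sum_comm]
  exact Finset.sum_congr rfl fun i _ => Finset.sum_congr rfl fun j _ => algTrace_mul_comm _ _

theorem pairing_smul_left (r : ℝ) (A B : Matrix (Fin n) (Fin n) S) :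
    pairing (r • A) B = r * pairing A B := by
  rw [pairing_comm, map_smul, pairing_comm, smul_eq_mul]

theorem pairing_add_left (A A' B : Matrix (Fin n) (Fin n) S) :
    pairing (A + A') B = pairing A B + pairing A' B := by
  rw [pairing_comm, map_add, pairing_comm, pairing_comm B]

variable [StarRing S]

theorem pairing_conjTranspose (hS : IsPositiveInvolution S) (A B : Matrix (Fin n) (Fin n) S) :
    pairing Aᴴ Bᴴ = pairing A B := by
  rw [pairing_apply, pairing_apply, Finset.sum_comm]
  refine Finset.sum_congr rfl fun i _ => Finset.sum_congr rfl fun j _ => ?_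
  rw [Matrix.conjTranspose_apply, Matrix.conjTranspose_apply, ← star_mul, hS.trace_star,
    algTrace_mul_comm]

theorem formValue_eq_pairing (Z : Matrix (Fin n) (Fin n) S) (y : Fin n → S) :
    formValue Z y = pairing Z (rankOneOf y) := by
  have : formValue Z y = algTrace S ((y ᵥ* Z) ⬝ᵥ star y) := rfl
  rw [this, pairing_apply, Finset.sum_comm]
  simp only [dotProduct, Matrix.vecMul, Pi.star_apply, Finset.sum_mul, map_sum, rankOneOf,
    Matrix.of_apply]
  refine Finset.sum_congr rfl fun i _ => Finset.sum_congr rfl fun j _ => ?_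
  rw [mul_assoc, algTrace_mul_comm, mul_assoc]

theorem formValue_rankOneOf (x y : Fin n → S) :
    formValue (rankOneOf x) y = algTrace S ((y ⬝ᵥ star x) * star (y ⬝ᵥ star x)) := by
  have : formValue (rankOneOf x) y = algTrace S ((y ᵥ* rankOneOf x) ⬝ᵥ star y) := rfl
  have hstar : star (y ⬝ᵥ star x) = x ⬝ᵥ star y := by simp [dotProduct]
  rw [this, hstar]
  congr 1
  simp only [dotProduct, Matrix.vecMul, Pi.star_apply, rankOneOf, Matrix.of_apply,
    Finset.sum_mul]
  rw [Finset.sum_comm]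
  simp only [mul_assoc, Finset.mul_sum]

theorem eq_zero_of_algTrace_mul (hS : IsPositiveInvolution S) {s : S}
    (h : ∀ t, algTrace S (s * t) = 0) : s = 0 := by
  by_contra hs
  exact (hS.trace_mul_star_pos s hs).ne' (h _)

theorem formValue_rankOneOf_nonneg (hS : IsPositiveInvolution S) (x y : Fin n → S) :
    0 ≤ formValue (rankOneOf x) y := by
  rw [formValue_rankOneOf]
  rcases eq_or_ne (y ⬝ᵥ star x) 0 with h | h
  · simp [h]
  · exact (hS.trace_mul_star_pos _ h).le

theorem formValue_rankOneOf_eq_zero (hS : IsPositiveInvolution S) (x y : Fin n → S) :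
    formValue (rankOneOf x) y = 0 ↔ y ⬝ᵥ star x = 0 := by
  rw [formValue_rankOneOf]
  refine ⟨fun h => ?_, fun h => by simp [h]⟩
  by_contra h0
  exact (hS.trace_mul_star_pos _ h0).ne' h

variable [StarModule ℝ S]

/-- The real bilinear form `Tr (y Z y'^*)` on `S^n`, whose diagonal is `Z[y]`. -/
noncomputable def realForm (Z : Matrix (Fin n) (Fin n) S) :
    LinearMap.BilinForm ℝ (Fin n → S) :=
  LinearMap.mk₂ ℝ (fun y y' => algTrace S ((y ᵥ* Z) ⬝ᵥ star y'))
    (by intros; rw [Matrix.add_vecMul, add_dotProduct, map_add])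
    (by intros; rw [Matrix.smul_vecMul, smul_dotProduct, map_smul])
    (by intros; rw [star_add, dotProduct_add, map_add])
    (by intros; rw [star_smul, star_trivial, dotProduct_smul, map_smul])

theorem realForm_apply (Z : Matrix (Fin n) (Fin n) S) (y y' : Fin n → S) :
    realForm Z y y' = algTrace S ((y ᵥ* Z) ⬝ᵥ star y') := rfl

theorem realForm_self (Z : Matrix (Fin n) (Fin n) S) (y : Fin n → S) :
    realForm Z y y = formValue Z y := rfl

theorem realForm_comm (hS : IsPositiveInvolution S) {Z : Matrix (Fin n) (Fin n) S}
    (hZ : Z.IsHermitian) (y y' : Fin n → S) : realForm Z y y' = realForm Z y' y := by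
  rw [realForm_apply, realForm_apply, ← hS.trace_star, ← Matrix.star_dotProduct_star, star_star,
    Matrix.star_vecMul, hZ, Matrix.dotProduct_mulVec]

theorem realForm_one_pos (hS : IsPositiveInvolution S) (y : Fin n → S) (hy : y ≠ 0) :
    0 < realForm 1 y y := by
  rw [realForm_apply, Matrix.vecMul_one, dotProduct, map_sum]
  obtain ⟨i, hi⟩ := Function.ne_iff.mp hy
  refine Finset.sum_pos' (fun j _ => ?_) ⟨i, Finset.mem_univ i, hS.trace_mul_star_pos _ hi⟩
  rcases eq_or_ne (y j) 0 with h | h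
  · simp [h]
  · exact (hS.trace_mul_star_pos _ h).le

/-- On Hermitian matrices, every linear functional is the pairing with a Hermitian matrix. -/
theorem exists_isHermitian_pairing_eq [FiniteDimensional ℝ S] (hS : IsPositiveInvolution S)
    (l : Matrix (Fin n) (Fin n) S →ₗ[ℝ] ℝ) :
    ∃ Z : Matrix (Fin n) (Fin n) S, Z.IsHermitian ∧
      ∀ p : Matrix (Fin n) (Fin n) S, p.IsHermitian → pairing Z p = l p := by
  let B : LinearMap.BilinForm ℝ (Matrix (Fin n) (Fin n) S) :=
    { toFun := pairing
      map_add' := fun A A' => LinearMap.ext fun p => pairing_add_left A A' p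
      map_smul' := fun r A => LinearMap.ext fun p => pairing_smul_left r A p }
  have hB : ∀ A, B A = pairing A := fun _ => rfl
  obtain ⟨A, hA⟩ := exists_eq_apply_of_nondegenerate B (fun A hA => by
    refine ⟨Aᴴ, ne_of_gt ?_⟩
    rw [hB, pairing_apply]
    obtain ⟨i, hi⟩ := Function.ne_iff.mp hA
    obtain ⟨j, hj⟩ := Function.ne_iff.mp hi
    have hnn : ∀ s : S, 0 ≤ algTrace S (s * star s) := fun s => by
      rcases eq_or_ne s 0 with h | h
      · simp [h]
      · exact (hS.trace_mul_star_pos _ h).le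
    exact Finset.sum_pos' (fun i _ => Finset.sum_nonneg fun j _ => hnn (A i j))
      ⟨i, Finset.mem_univ i, Finset.sum_pos' (fun j _ => hnn (A i j))
        ⟨j, Finset.mem_univ j, hS.trace_mul_star_pos _ hj⟩⟩) l
  rw [hB] at hA
  refine ⟨(1 / 2 : ℝ) • (A + Aᴴ), ?_, fun p hp => ?_⟩
  · rw [Matrix.IsHermitian, Matrix.conjTranspose_smul, star_trivial, Matrix.conjTranspose_add,
      Matrix.conjTranspose_conjTranspose, add_comm]
  · have : pairing Aᴴ p = pairing A p := by
      rw [← pairing_conjTranspose hS A p, hp]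
    rw [pairing_smul_left, pairing_add_left, this, hA]
    ring

theorem exists_ne_zero_orthogonal [FiniteDimensional ℝ S] (hS : IsPositiveInvolution S)
    {N : Submodule S (Fin n → S)} (hN : N ≠ ⊤) :
    ∃ y : Fin n → S, y ≠ 0 ∧ ∀ x ∈ N, y ⬝ᵥ star x = 0 := by
  have hlt : N.restrictScalars ℝ < ⊤ := lt_top_iff_ne_top.mpr fun h => hN (by
    rwa [Submodule.restrictScalars_eq_top_iff] at h)
  obtain ⟨l, hl0, hl⟩ := Submodule.exists_le_ker_of_lt_top _ hlt
  obtain ⟨y, rfl⟩ := exists_eq_apply_of_nondegenerate (realForm (1 : Matrix (Fin n) (Fin n) S))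
    (fun y hy => ⟨y, (realForm_one_pos hS y hy).ne'⟩) l
  refine ⟨y, fun h => hl0 (by rw [h, map_zero]), fun x hx => ?_⟩
  refine eq_zero_of_algTrace_mul hS fun t => ?_
  have h1 : star t • x ∈ N := N.smul_mem _ hx
  have h2 := LinearMap.mem_ker.mp (hl h1)
  rw [realForm_apply, Matrix.vecMul_one] at h2
  rw [← h2]
  congr 1
  simp [dotProduct, Finset.sum_mul, mul_assoc]

end Forms

/-! ### Convex hulls and intrinsic interiors -/

section Convex

/-- Where a linear functional attains its minimum over a convex hull, only generators of minimal
value contribute. -/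
theorem le_and_mem_convexHull_of_eq {E : Type*} [AddCommGroup E] [Module ℝ E] (f : E →ₗ[ℝ] ℝ)
    {A : Set E} {c : ℝ} (h : ∀ a ∈ A, c ≤ f a) {p : E} (hp : p ∈ convexHull ℝ A) :
    c ≤ f p ∧ (f p = c → p ∈ convexHull ℝ {a ∈ A | f a = c}) := by
  have hK : Convex ℝ {p | c ≤ f p ∧ (f p = c → p ∈ convexHull ℝ {a ∈ A | f a = c})} := by
    rintro x ⟨hx, hx'⟩ y ⟨hy, hy'⟩ a b ha hb hab
    have hc : c = a * c + b * c := by rw [← add_mul, hab, one_mul]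
    have h1 := mul_le_mul_of_nonneg_left hx ha
    have h2 := mul_le_mul_of_nonneg_left hy hb
    simp only [Set.mem_ofPred_eq, map_add, map_smul, smul_eq_mul]
    refine ⟨by linarith, fun heq => ?_⟩
    rcases ha.eq_or_lt with rfl | ha
    · rw [zero_add] at hab
      subst hab
      rw [zero_smul, one_smul, zero_add]
      exact hy' (by linarith)
    rcases hb.eq_or_lt with rfl | hb
    · rw [add_zero] at hab
      subst hab
      rw [zero_smul, one_smul, add_zero]
      exact hx' (by linarith)
    exact convex_convexHull ℝ _ (hx' (mul_left_cancel₀ ha.ne' (by linarith)))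
      (hy' (mul_left_cancel₀ hb.ne' (by linarith))) ha.le hb.le hab
  refine convexHull_min ?_ hK hp
  exact fun a ha => ⟨h a ha, fun he => subset_convexHull ℝ {a ∈ A | f a = c} ⟨ha, he⟩⟩

variable {E : Type*} [AddCommGroup E] [Module ℝ E] [TopologicalSpace E] [IsTopologicalAddGroup E]
  [ContinuousSMul ℝ E]

/-- From a relative interior point one can move a little further away from any point of the set. -/
theorem exists_add_smul_sub_mem {F : Set E} {p c : E} (hp : p ∈ intrinsicInterior ℝ F)
    (hc : c ∈ F) : ∃ ε : ℝ, 0 < ε ∧ p + ε • (p - c) ∈ F := by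
  obtain ⟨y, hy, rfl⟩ := hp
  have hmem : ∀ t : ℝ, (y : E) + t • ((y : E) - c) ∈ affineSpan ℝ F := fun t => by
    have := AffineMap.lineMap_mem (1 + t) (subset_affineSpan ℝ F hc) y.2
    rw [AffineMap.lineMap_apply_module'] at this
    convert this using 1
    module
  let γ : ℝ → affineSpan ℝ F := fun t => ⟨_, hmem t⟩
  have hγ : Continuous γ := Continuous.subtype_mk (by fun_prop) _
  have hγ0 : γ 0 = y := Subtype.ext (by simp [γ])
  have hev := hγ.continuousAt.eventually_mem (x := 0)
    (hγ0 ▸ mem_interior_iff_mem_nhds.mp hy)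
  obtain ⟨ε, hε, hε0⟩ := ((hev.filter_mono nhdsWithin_le_nhds).and
    (self_mem_nhdsWithin (a := (0 : ℝ)) (s := Set.Ioi 0))).exists
  exact ⟨ε, hε0, hε⟩

/-- Mathlib has this for normed spaces; the topology of matrices over `S` comes without a norm. -/
theorem intrinsicInterior_nonempty_of_convex [T2Space E] [FiniteDimensional ℝ E] {F : Set E}
    (hF : Convex ℝ F) (hne : F.Nonempty) : (intrinsicInterior ℝ F).Nonempty := by
  let e := toEuclidean (E := E)
  obtain ⟨_, ⟨y, hy, rfl⟩⟩ := (hne.image e).intrinsicInterior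
    (hF.linear_image e.toLinearEquiv.toLinearMap)
  have hmap : ∀ x : affineSpan ℝ F, e x ∈ affineSpan ℝ (e '' F) := fun x => by
    have := AffineSubspace.map_span e.toLinearEquiv.toLinearMap.toAffineMap F
    change e x ∈ affineSpan ℝ (e.toLinearEquiv.toLinearMap.toAffineMap '' F)
    rw [← this]
    exact ⟨x, x.2, rfl⟩
  have hmap' : e.symm y ∈ affineSpan ℝ F := by
    have hy2 : (y : EuclideanSpace ℝ _) ∈
      affineSpan ℝ (e.toLinearEquiv.toLinearMap.toAffineMap '' F) := y.2
    rw [← AffineSubspace.map_span] at hy2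
    obtain ⟨x, hx, hxy⟩ := hy2
    rw [← hxy]
    change e.symm (e x) ∈ _
    rwa [e.symm_apply_apply]
  let g : affineSpan ℝ F → affineSpan ℝ (e '' F) := fun x => ⟨e x, hmap x⟩
  have hg : Continuous g := Continuous.subtype_mk (e.continuous.comp continuous_subtype_val) _
  refine ⟨_, ⟨e.symm y, hmap'⟩, ?_, rfl⟩
  have hgy : g ⟨e.symm y, hmap'⟩ = y := Subtype.ext (e.apply_symm_apply _)
  rw [mem_interior_iff_mem_nhds] at hy ⊢
  filter_upwards [hg.continuousAt.eventually_mem (hgy ▸ hy)] with x hx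
  obtain ⟨x', hx', hxx'⟩ := hx
  rwa [Set.mem_preimage, ← e.injective hxx']

end Convex

/-! ### Positivity of Hermitian forms with a weighted minimum -/

section Correspondence

variable {D S : Type*} [Ring S] [StarRing S] [Algebra ℝ S] {n : ℕ}

theorem pairing_weightedPoint {ι : D → S} {w : (Fin n → D) → ℝ} (Z : Matrix (Fin n) (Fin n) S)
    (x : Fin n → D) :
    pairing Z (weightedPoint ι w x) = w x * formValue Z (vecEmb ι x) := by
  rw [formValue_eq_pairing]
  exact map_smul _ _ _

theorem pairing_eq_of_mem_convexHull {ι : D → S} {w : (Fin n → D) → ℝ}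
    {Z : Matrix (Fin n) (Fin n) S} {c : ℝ}
    {M : Set (Fin n → D)} (hM : ∀ x ∈ M, w x * formValue Z (vecEmb ι x) = c)
    {p : Matrix (Fin n) (Fin n) S} (hp : p ∈ convexHull ℝ (weightedPoint ι w '' M)) :
    pairing Z p = c := by
  have hconv : Convex ℝ {p | pairing Z p = c} :=
    (convex_singleton c).linear_preimage (pairing Z)
  refine convexHull_min ?_ hconv hp
  rintro _ ⟨x, hx, rfl⟩
  rw [Set.mem_ofPred_eq, pairing_weightedPoint, hM x hx]

theorem convex_isHermitian [StarModule ℝ S] :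
    Convex ℝ {p : Matrix (Fin n) (Fin n) S | p.IsHermitian} := by
  intro x hx y hy a b _ _ _
  rw [Set.mem_ofPred_eq, Matrix.IsHermitian, Matrix.conjTranspose_add, Matrix.conjTranspose_smul,
    Matrix.conjTranspose_smul, star_trivial, star_trivial, hx, hy]

theorem isHermitian_of_mem_convexHull [StarModule ℝ S]
    {ι : D → S} {w : (Fin n → D) → ℝ} {M : Set (Fin n → D)} {p : Matrix (Fin n) (Fin n) S}
    (hp : p ∈ convexHull ℝ (weightedPoint ι w '' M)) : p.IsHermitian := by
  refine convexHull_min (t := {p | p.IsHermitian}) ?_ convex_isHermitian hp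
  rintro _ ⟨x, -, rfl⟩
  rw [Set.mem_ofPred_eq, Matrix.IsHermitian, weightedPoint, Matrix.conjTranspose_smul,
    star_trivial]
  congr 1
  exact isHermitian_rankOneOf (vecEmb ι x)

variable [DivisionRing D]

/-- What the correspondence uses of the arithmetic situation: the involution of `S` is positive,
`L₀` maps bijectively onto the integral combinations of some real basis of `S^n`, and the weights
of non-zero lattice vectors lie between two positive constants. -/
structure IsAdmissible (ι : D → S) (L₀ : AddSubgroup (Fin n → D)) (w : (Fin n → D) → ℝ) :
    Prop where
  positive : IsPositiveInvolution S
  basis : ∃ (N : ℕ) (e : Module.Basis (Fin N) ℝ (Fin n → S)),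
    (∀ x ∈ L₀, ∃ z : Fin N → ℤ, vecEmb ι x = ∑ i, (z i : ℝ) • e i) ∧
    ∀ z : Fin N → ℤ, ∃ x ∈ L₀, vecEmb ι x = ∑ i, (z i : ℝ) • e i
  injective : Function.Injective (vecEmb ι : (Fin n → D) → Fin n → S)
  zero : vecEmb ι (0 : Fin n → D) = 0
  bounds : ∃ c₁ c₂ : ℝ, 0 < c₁ ∧ ∀ x ∈ L₀, x ≠ 0 → c₁ ≤ w x ∧ w x ≤ c₂

variable {ι : D → S} {L₀ : AddSubgroup (Fin n → D)} {w : (Fin n → D) → ℝ}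

theorem pairing_ge_of_mem_hull {Z : Matrix (Fin n) (Fin n) S} {c : ℝ}
    (hZ : ∀ x ∈ L₀, x ≠ 0 → c ≤ w x * formValue Z (vecEmb ι x))
    {p : Matrix (Fin n) (Fin n) S} (hp : p ∈ hull ι L₀ w) :
    c ≤ pairing Z p ∧ (pairing Z p = c → p ∈ convexHull ℝ (weightedPoint ι w ''
      {x | x ∈ L₀ ∧ x ≠ 0 ∧ w x * formValue Z (vecEmb ι x) = c})) := by
  have := le_and_mem_convexHull_of_eq (pairing Z) (c := c) (by
    rintro _ ⟨x, hx, rfl⟩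
    rw [pairing_weightedPoint]
    exact hZ x hx.1 hx.2) hp
  refine ⟨this.1, fun h => convexHull_mono ?_ (this.2 h)⟩
  rintro _ ⟨⟨x, hx, rfl⟩, he⟩
  rw [pairing_weightedPoint] at he
  exact ⟨x, ⟨hx.1, hx.2, he⟩, rfl⟩

namespace IsAdmissible

variable (h : IsAdmissible ι L₀ w)
include h

theorem weight_pos {x : Fin n → D} (hx : x ∈ L₀) (hx0 : x ≠ 0) : 0 < w x := by
  obtain ⟨c₁, c₂, hc, hw⟩ := h.bounds
  exact hc.trans_le (hw x hx hx0).1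

theorem vecEmb_ne_zero {x : Fin n → D} (hx : x ≠ 0) : vecEmb ι x ≠ 0 := fun h0 =>
  hx (h.injective (h0.trans h.zero.symm))

theorem infinite_nonzero (hne : ∃ x ∈ L₀, x ≠ 0) : {x | x ∈ L₀ ∧ x ≠ 0}.Infinite := by
  obtain ⟨x, hx, hx0⟩ := hne
  obtain ⟨N, e, hLe, heL⟩ := h.basis
  obtain ⟨z, hz⟩ := hLe x hx
  choose f hf hfz using fun k : ℕ => heL fun i => (k + 1 : ℕ) * z i
  have hfx : ∀ k, vecEmb ι (f k) = ((k + 1 : ℕ) : ℝ) • vecEmb ι x := fun k => by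
    rw [hfz, hz, Finset.smul_sum]
    simp only [smul_smul]
    push_cast
    rfl
  have hxe := h.vecEmb_ne_zero hx0
  refine Set.infinite_of_injective_forall_mem (f := f) (fun k l hkl => ?_) fun k => ⟨hf k, ?_⟩
  · have := congrArg (vecEmb ι) hkl
    rw [hfx, hfx] at this
    have := smul_left_injective ℝ hxe this
    exact Nat.succ_injective (Nat.cast_injective this)
  · intro h0
    have := hfx k
    rw [h0, h.zero] at this
    exact smul_ne_zero (by positivity) hxe this.symm

variable [StarModule ℝ S]

theorem finite_weighted_le {Z : Matrix (Fin n) (Fin n) S} (hZ : Z ∈ posCone n S) (C : ℝ) :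
    {x | x ∈ L₀ ∧ x ≠ 0 ∧ w x * formValue Z (vecEmb ι x) ≤ C}.Finite := by
  obtain ⟨N, e, hLe, -⟩ := h.basis
  obtain ⟨c₁, c₂, hc, hw⟩ := h.bounds
  have hfin := finite_integral_le e (realForm Z) (realForm_comm h.positive hZ.1) hZ.2 (C / c₁)
  refine Set.Finite.of_finite_image ((hfin.image fun z => ∑ i, (z i : ℝ) • e i).subset ?_)
    h.injective.injOn
  rintro _ ⟨x, ⟨hx, hx0, hxC⟩, rfl⟩
  obtain ⟨z, hz⟩ := hLe x hx
  refine ⟨z, ?_, hz.symm⟩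
  rw [Set.mem_ofPred_eq, ← hz, le_div_iff₀ hc, realForm_self]
  have := hZ.2 _ (h.vecEmb_ne_zero hx0)
  nlinarith [(hw x hx hx0).1]

/-- If the weighted values of `Z` on the lattice are bounded below, by any real number, then `Z` is
positive semidefinite: a negative value would become arbitrarily negative on multiples. -/
theorem formValue_nonneg {Z : Matrix (Fin n) (Fin n) S} (hZ : Z.IsHermitian) {c : ℝ}
    (hc : ∀ x ∈ L₀, x ≠ 0 → c ≤ w x * formValue Z (vecEmb ι x)) (y : Fin n → S) :
    0 ≤ formValue Z y := by
  obtain ⟨N, e, -, heL⟩ := h.basis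
  obtain ⟨c₁, c₂, hc₁, hw⟩ := h.bounds
  refine nonneg_of_integral_nonneg e (realForm Z) (realForm_comm h.positive hZ) (fun z => ?_) y
  by_contra! hneg
  set v := ∑ i, (z i : ℝ) • e i with hv
  set Q := realForm Z v v with hQ
  obtain ⟨k, hk⟩ := exists_nat_gt (max 1 (|c| / (c₁ * -Q)))
  have hk1 : (1 : ℝ) < k := (le_max_left _ _).trans_lt hk
  have hkc : |c| < k * (c₁ * -Q) :=
    (div_lt_iff₀ (mul_pos hc₁ (by linarith))).mp ((le_max_right _ _).trans_lt hk)
  obtain ⟨x, hx, hxz⟩ := heL fun i => k * z i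
  have hxv : vecEmb ι x = (k : ℝ) • v := by
    rw [hxz, hv, Finset.smul_sum]
    simp only [smul_smul]
    push_cast
    rfl
  have hval : formValue Z (vecEmb ι x) = k * (k * Q) := by
    rw [← realForm_self, hxv, map_smul, map_smul, LinearMap.smul_apply, smul_eq_mul, smul_eq_mul]
  have hkQ : (k : ℝ) * (k * Q) < 0 :=
    mul_neg_of_pos_of_neg (by linarith) (mul_neg_of_pos_of_neg (by linarith) hneg)
  have hx0 : x ≠ 0 := by
    rintro rfl
    rw [h.zero] at hval
    rw [← realForm_self, map_zero] at hval
    exact hkQ.ne hval.symm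
  have h1 := hc x hx hx0
  rw [hval] at h1
  have h2 : w x * (k * (k * Q)) ≤ c₁ * (k * (k * Q)) :=
    mul_le_mul_of_nonpos_right (hw x hx hx0).1 hkQ.le
  have h3 := neg_abs_le c
  have h4 : (k : ℝ) * (c₁ * -Q) ≤ k * (k * (c₁ * -Q)) :=
    le_mul_of_one_le_left (mul_nonneg (by linarith) (mul_nonneg hc₁.le (by linarith))) hk1.le
  linarith

theorem mem_posCone {Z : Matrix (Fin n) (Fin n) S} (hZ : Z.IsHermitian) {c : ℝ} (hc0 : 0 < c)
    (hc : ∀ x ∈ L₀, x ≠ 0 → c ≤ w x * formValue Z (vecEmb ι x)) : Z ∈ posCone n S := by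
  refine ⟨hZ, ?_⟩
  obtain ⟨N, e, -, heL⟩ := h.basis
  obtain ⟨c₁, c₂, hc₁, hw⟩ := h.bounds
  have hmax : 0 < max c₂ 1 := lt_max_of_lt_right one_pos
  refine pos_of_integral_ge e (realForm Z) (realForm_comm h.positive hZ) (div_pos hc0 hmax)
    (fun z hz => ?_)
  obtain ⟨x, hx, hxz⟩ := heL z
  have hx0 : x ≠ 0 := by
    rintro rfl
    rw [h.zero] at hxz
    refine hz (funext fun i => ?_)
    have := congrArg (fun v => e.repr v i) hxz
    simp only [map_zero, e.repr_sum_self] at this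
    simpa using this.symm
  rw [← hxz, realForm_self, div_le_iff₀ hmax, mul_comm]
  exact (hc x hx hx0).trans (mul_le_mul_of_nonneg_right
    ((hw x hx hx0).2.trans (le_max_left _ _)) (h.formValue_nonneg hZ hc _))

theorem intrinsicInterior_subset_posCone [TopologicalSpace S] [IsTopologicalAddGroup S]
    [ContinuousSMul ℝ S] {M : Set (Fin n → D)} 
    (hM : ∀ x ∈ M, x ∈ L₀ ∧ x ≠ 0) (hspan : Submodule.span S (vecEmb ι '' M) = ⊤) :
    intrinsicInterior ℝ (convexHull ℝ (weightedPoint ι w '' M)) ⊆ posCone n S := by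
  intro p hp
  refine ⟨isHermitian_of_mem_convexHull (intrinsicInterior_subset hp), fun y hy => ?_⟩
  have hval : ∀ x, pairing (rankOneOf y) (weightedPoint ι w x) =
      w x * formValue (rankOneOf (vecEmb ι x)) y := fun x => by
    rw [pairing_weightedPoint, formValue_eq_pairing, pairing_comm, ← formValue_eq_pairing]
  have hnn : ∀ x ∈ M, 0 ≤ pairing (rankOneOf y) (weightedPoint ι w x) := fun x hx => by
    rw [hval]
    exact mul_nonneg (h.weight_pos (hM x hx).1 (hM x hx).2).le
      (formValue_rankOneOf_nonneg h.positive _ _)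
  have hnn' : ∀ q ∈ convexHull ℝ (weightedPoint ι w '' M), 0 ≤ pairing (rankOneOf y) q :=
    fun q hq => (le_and_mem_convexHull_of_eq (pairing (rankOneOf y)) (by
      rintro _ ⟨x, hx, rfl⟩
      exact hnn x hx) hq).1
  obtain ⟨x₁, hx₁, hx₁0⟩ : ∃ x ∈ M, 0 < pairing (rankOneOf y) (weightedPoint ι w x) := by
    by_contra! hall
    have horth := orthogonal_of_span hspan (y := y) (by
      rintro _ ⟨x, hx, rfl⟩
      rw [← formValue_rankOneOf_eq_zero h.positive]
      have := le_antisymm (hall x hx) (hnn x hx)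
      rw [hval] at this
      exact (mul_eq_zero.mp this).resolve_left (h.weight_pos (hM x hx).1 (hM x hx).2).ne') y
    have := realForm_one_pos h.positive y hy
    rw [realForm_apply, Matrix.vecMul_one, horth, map_zero] at this
    exact lt_irrefl _ this
  obtain ⟨ε, hε, hq⟩ := exists_add_smul_sub_mem hp (subset_convexHull ℝ _ ⟨x₁, hx₁, rfl⟩)
  have := hnn' _ hq
  rw [map_add, map_smul, map_sub, smul_eq_mul] at this
  rw [formValue_eq_pairing, pairing_comm]
  nlinarith

variable [FiniteDimensional ℝ S]

/-- A vector orthogonal to all of `M` is isotropic for every convex combination of the points of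
`M`. -/
theorem span_eq_top {M : Set (Fin n → D)} {p : Matrix (Fin n) (Fin n) S}
    (hp : p ∈ posCone n S) (hpM : p ∈ convexHull ℝ (weightedPoint ι w '' M)) :
    Submodule.span S (vecEmb ι '' M) = ⊤ := by
  by_contra hne
  obtain ⟨y, hy, hyM⟩ := exists_ne_zero_orthogonal h.positive hne
  refine (hp.2 y hy).ne' ?_
  rw [formValue_eq_pairing, pairing_comm]
  refine pairing_eq_of_mem_convexHull (fun x hx => ?_) hpM
  have : formValue (rankOneOf y) (vecEmb ι x) = 0 := by
    rw [formValue_eq_pairing, pairing_comm, ← formValue_eq_pairing,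
      formValue_rankOneOf_eq_zero h.positive]
    exact hyM _ (Submodule.subset_span ⟨x, hx, rfl⟩)
  rw [this, mul_zero]

end IsAdmissible

end Correspondence

/-! ### The correspondence between faces and cells -/

section Correspondence

variable {D S : Type*} [DivisionRing D] [Ring S] [StarRing S] [Algebra ℝ S] {n : ℕ}
  {ι : D → S} {L₀ : AddSubgroup (Fin n → D)} {w : (Fin n → D) → ℝ}

theorem minimalVectors_eq_of_mem_openCell {M : Set (Fin n → D)}
    (hM : ∀ x ∈ M, x ∈ L₀ ∧ x ≠ 0) {Z : Matrix (Fin n) (Fin n) S} (hZ : Z ∈ openCell ι L₀ w M) :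
    minimalVectors ι L₀ w Z = M := by
  ext x
  refine ⟨fun hx => ?_, fun hx => ⟨(hM x hx).1, (hM x hx).2, hZ.2.1 x hx⟩⟩
  by_contra hxM
  exact (hZ.2.2 x hx.1 hx.2.1 hxM).ne' hx.2.2

theorem one_le_of_mem_openCell {M : Set (Fin n → D)} {Z : Matrix (Fin n) (Fin n) S}
    (hZ : Z ∈ openCell ι L₀ w M) {x : Fin n → D} (hx : x ∈ L₀) (hx0 : x ≠ 0) :
    1 ≤ w x * formValue Z (vecEmb ι x) := by
  by_cases hxM : x ∈ M
  · exact (hZ.2.1 x hxM).ge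
  · exact (hZ.2.2 x hx hx0 hxM).le

theorem convexHull_eq_setOf_pairing_eq_one {M : Set (Fin n → D)}
    (hM : ∀ x ∈ M, x ∈ L₀ ∧ x ≠ 0) {Z : Matrix (Fin n) (Fin n) S} (hZ : Z ∈ openCell ι L₀ w M) :
    convexHull ℝ (weightedPoint ι w '' M) = {p ∈ hull ι L₀ w | pairing Z p = 1} := by
  refine Set.Subset.antisymm (fun p hp => ⟨?_, pairing_eq_of_mem_convexHull hZ.2.1 hp⟩) ?_
  · exact convexHull_mono (Set.image_mono hM) hp
  · rintro p ⟨hp, hp1⟩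
    have := (pairing_ge_of_mem_hull (fun x hx hx0 => one_le_of_mem_openCell hZ hx hx0) hp).2 hp1
    rw [← minimalVectors_eq_of_mem_openCell hM hZ]
    exact this

theorem IsCellIndex.nonempty_index {M : Set (Fin n → D)} (hM : IsCellIndex ι L₀ w M) :
    M.Nonempty := by
  obtain ⟨Z, hZ⟩ := hM.nonempty
  obtain ⟨x, hx, hx1⟩ := (hM.well_rounded hZ).2.1.1
  exact ⟨x, minimalVectors_eq_of_mem_openCell hM.subset hZ ▸ ⟨hx.1, hx.2, hx1⟩⟩

theorem IsCellIndex.span_eq_top {M : Set (Fin n → D)} (hM : IsCellIndex ι L₀ w M) :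
    Submodule.span S (vecEmb ι '' M) = ⊤ := by
  obtain ⟨Z, hZ⟩ := hM.nonempty
  have := (hM.well_rounded hZ).2.2
  rwa [minimalVectors_eq_of_mem_openCell hM.subset hZ] at this

theorem IsCellIndex.faceVectors_convexHull {M : Set (Fin n → D)} (hM : IsCellIndex ι L₀ w M) :
    faceVectors ι L₀ w (convexHull ℝ (weightedPoint ι w '' M)) = M := by
  obtain ⟨Z, hZ⟩ := hM.nonempty
  refine Set.Subset.antisymm ?_ fun x hx =>
    ⟨(hM.subset x hx).1, (hM.subset x hx).2, subset_convexHull ℝ _ ⟨x, hx, rfl⟩⟩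
  rintro x ⟨hx, hx0, hxF⟩
  rw [← minimalVectors_eq_of_mem_openCell hM.subset hZ]
  rw [convexHull_eq_setOf_pairing_eq_one hM.subset hZ] at hxF
  exact ⟨hx, hx0, by rw [← pairing_weightedPoint]; exact hxF.2⟩

/-- A closed cell determines its index because `σ(M')` consists of points of it whose minimal
vectors are exactly those in `M'`. -/
theorem closedCell_subset_iff {M M' : Set (Fin n → D)} (hM : IsCellIndex ι L₀ w M)
    (hM' : IsCellIndex ι L₀ w M') :
    closedCell ι L₀ w M' ⊆ closedCell ι L₀ w M ↔ M ⊆ M' := by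
  refine ⟨fun h x hx => ?_, fun h Z hZ => ⟨hZ.1, fun x hx => hZ.2.1 x (h hx), hZ.2.2⟩⟩
  obtain ⟨Z, hZ⟩ := hM'.nonempty
  have hZM := h ⟨hZ.1, hZ.2.1, fun x hx hx0 => one_le_of_mem_openCell hZ hx hx0⟩
  rw [← minimalVectors_eq_of_mem_openCell hM'.subset hZ]
  exact ⟨(hM.subset x hx).1, (hM.subset x hx).2, hZM.2.1 x hx⟩

namespace IsAdmissible

variable [StarModule ℝ S] [FiniteDimensional ℝ S] [TopologicalSpace S] [IsTopologicalAddGroup S]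
  [ContinuousSMul ℝ S] [T2Space S] (h : IsAdmissible ι L₀ w)
include h

theorem isHecketopeFace_convexHull {M : Set (Fin n → D)} (hM : IsCellIndex ι L₀ w M) :
    IsHecketopeFace ι L₀ w (convexHull ℝ (weightedPoint ι w '' M)) := by
  obtain ⟨Z, hZ⟩ := hM.nonempty
  obtain ⟨x₀, hx₀⟩ := hM.nonempty_index
  refine ⟨fun _ => ?_, ?_, fun heq => ?_,
    h.intrinsicInterior_subset_posCone hM.subset hM.span_eq_top⟩
  · refine ⟨-LinearMap.toContinuousLinearMap (pairing Z), ?_⟩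
    rw [convexHull_eq_setOf_pairing_eq_one hM.subset hZ]
    ext p
    simp only [Set.mem_ofPred_eq, neg_apply,
      LinearMap.coe_toContinuousLinearMap', neg_le_neg_iff]
    have hge := fun (q : Matrix (Fin n) (Fin n) S) (hq : q ∈ hull ι L₀ w) =>
      (pairing_ge_of_mem_hull (fun x hx hx0 => one_le_of_mem_openCell hZ hx hx0) hq).1
    refine and_congr_right fun hp => ⟨fun hp1 q hq => hp1.trans_le (hge q hq), fun hmin => ?_⟩
    refine le_antisymm ?_ (hge p hp)
    rw [← hZ.2.1 x₀ hx₀, ← pairing_weightedPoint]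
    exact hmin _ (subset_convexHull ℝ _ ⟨x₀, hM.subset x₀ hx₀, rfl⟩)
  · exact ⟨_, subset_convexHull ℝ _ ⟨x₀, hx₀, rfl⟩⟩
  · refine h.infinite_nonzero ⟨x₀, (hM.subset x₀ hx₀)⟩ (hM.finite.subset fun x hx => ?_)
    have hxF : weightedPoint ι w x ∈ convexHull ℝ (weightedPoint ι w '' M) := by
      rw [heq]
      exact subset_convexHull ℝ _ ⟨x, hx, rfl⟩
    rw [← hM.faceVectors_convexHull]
    exact ⟨hx.1, hx.2, hxF⟩

/-- The linear functional that cuts out a face is `-Z` for some `Z ∈ X` with weighted minimum `1`.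
That the relative interior of the face meets `X`, and that the face is proper, rules out that the
maximal value of the functional is `0`. -/
theorem exists_posCone_of_face {F : Set (Matrix (Fin n) (Fin n) S)}
    (hF : IsHecketopeFace ι L₀ w F) :
    ∃ Z ∈ posCone n S, (∀ x ∈ L₀, x ≠ 0 → 1 ≤ w x * formValue Z (vecEmb ι x)) ∧
      F = {p ∈ hull ι L₀ w | pairing Z p = 1} := by
  obtain ⟨l, hl⟩ := hF.exposed hF.nonempty
  obtain ⟨Z, hZ, hZl⟩ := exists_isHermitian_pairing_eq h.positive (-l : StrongDual ℝ _).toLinearMap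
  replace hZl : ∀ p ∈ hull ι L₀ w, pairing Z p = -l p := fun p hp =>
    hZl p (isHermitian_of_mem_convexHull hp)
  have hFconv : Convex ℝ F := hF.exposed.convex (convex_convexHull ℝ _)
  obtain ⟨p, hp⟩ := intrinsicInterior_nonempty_of_convex hFconv hF.nonempty
  have hpX := hF.interior_subset hp
  have hpF := intrinsicInterior_subset hp
  have hpH : p ∈ hull ι L₀ w := by rw [hl] at hpF; exact hpF.1
  have hmin : ∀ q ∈ hull ι L₀ w, pairing Z p ≤ pairing Z q := fun q hq => by
    rw [hZl p hpH, hZl q hq, neg_le_neg_iff]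
    rw [hl] at hpF
    exact hpF.2 q hq
  have hFeq : F = {q ∈ hull ι L₀ w | pairing Z q = pairing Z p} := by
    ext q
    refine ⟨fun hq => ?_, fun hq => ?_⟩
    · rw [hl] at hq
      refine ⟨hq.1, le_antisymm ?_ (hmin q hq.1)⟩
      rw [hZl p hpH, hZl q hq.1, neg_le_neg_iff]
      exact hq.2 p hpH
    · have hqp : l q = l p := by
        have := hq.2
        rw [hZl p hpH, hZl q hq.1] at this
        exact neg_injective this
      rw [hl] at hpF ⊢
      exact ⟨hq.1, fun y hy => hqp ▸ hpF.2 y hy⟩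
  set c := pairing Z p with hcdef
  have hc : ∀ x ∈ L₀, x ≠ 0 → c ≤ w x * formValue Z (vecEmb ι x) := fun x hx hx0 => by
    rw [← pairing_weightedPoint]
    exact hmin _ (subset_convexHull ℝ _ ⟨x, ⟨hx, hx0⟩, rfl⟩)
  have hpM := (pairing_ge_of_mem_hull hc hpH).2 rfl
  have hspan := h.span_eq_top hpX hpM
  have hnn := h.formValue_nonneg hZ hc
  have hc0 : 0 ≤ c := (pairing_ge_of_mem_hull (fun x hx hx0 =>
    mul_nonneg (h.weight_pos hx hx0).le (hnn _)) hpH).1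
  have hcpos : 0 < c := by
    -- If the minimum were `0`, all vectors of the face would lie in the radical of `Z`; since they
    -- span `S^n`, the form `Z` would vanish and the face would be the whole hull.
    refine lt_of_le_of_ne hc0 fun hc00 => hF.proper ?_
    have hker : ∀ y : Fin n → S, y ᵥ* Z = 0 := by
      intro y
      have hy : y ∈ Submodule.span S (vecEmb ι '' {x | x ∈ L₀ ∧ x ≠ 0 ∧
        w x * formValue Z (vecEmb ι x) = c}) := hspan ▸ Submodule.mem_top
      have hle : Submodule.span S (vecEmb ι '' {x | x ∈ L₀ ∧ x ≠ 0 ∧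
          w x * formValue Z (vecEmb ι x) = c}) ≤ LinearMap.ker (Matrix.toLinearMapRight' Z) := by
        rw [Submodule.span_le]
        rintro _ ⟨x, ⟨hx, hx0, hxc⟩, rfl⟩
        rw [← hc00] at hxc
        have hx00 := (mul_eq_zero.mp hxc).resolve_left (h.weight_pos hx hx0).ne'
        rw [SetLike.mem_coe, LinearMap.mem_ker, Matrix.toLinearMapRight'_apply]
        by_contra hne
        have hCS := LinearMap.BilinForm.apply_sq_le_of_symm (realForm Z) hnn
          ⟨realForm_comm h.positive hZ⟩ (vecEmb ι x) (vecEmb ι x ᵥ* Z)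
        rw [realForm_self, hx00, zero_mul] at hCS
        have h0 := pow_eq_zero_iff two_ne_zero |>.mp (le_antisymm hCS (sq_nonneg _))
        have := realForm_one_pos h.positive _ hne
        rw [realForm_apply, Matrix.vecMul_one] at this
        exact this.ne' h0
      exact LinearMap.mem_ker.mp (hle hy)
    rw [hFeq]
    refine Set.Subset.antisymm (fun q hq => hq.1) fun q hq => ⟨hq, ?_⟩
    rw [← hc00]
    refine pairing_eq_of_mem_convexHull (M := {x | x ∈ L₀ ∧ x ≠ 0}) (fun x _ => ?_) hq
    rw [← realForm_self, realForm_apply, hker, zero_dotProduct, map_zero, mul_zero]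
  have hscale : ∀ x ∈ L₀, x ≠ 0 → 1 ≤ w x * formValue (c⁻¹ • Z) (vecEmb ι x) := by
    intro x hx hx0
    rw [formValue_eq_pairing, pairing_smul_left, ← formValue_eq_pairing, mul_left_comm]
    have := mul_le_mul_of_nonneg_left (hc x hx hx0) (inv_nonneg.mpr hc0)
    rwa [inv_mul_cancel₀ hcpos.ne'] at this
  refine ⟨c⁻¹ • Z, h.mem_posCone ?_ one_pos hscale, hscale, ?_⟩
  · rw [Matrix.IsHermitian, Matrix.conjTranspose_smul, star_trivial, hZ]
  · rw [hFeq]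
    ext q
    refine and_congr_right fun _ => ?_
    rw [pairing_smul_left, inv_mul_eq_one₀ hcpos.ne', eq_comm]

theorem isCellIndex_faceVectors {F : Set (Matrix (Fin n) (Fin n) S)}
    (hF : IsHecketopeFace ι L₀ w F) :
    IsCellIndex ι L₀ w (faceVectors ι L₀ w F) ∧
      F = convexHull ℝ (weightedPoint ι w '' faceVectors ι L₀ w F) := by
  obtain ⟨Z, hZ, hZ1, hFeq⟩ := h.exists_posCone_of_face hF
  have hM : faceVectors ι L₀ w F =
      {x | x ∈ L₀ ∧ x ≠ 0 ∧ w x * formValue Z (vecEmb ι x) = 1} := by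
    ext x
    refine ⟨fun hx => ⟨hx.1, hx.2.1, ?_⟩, fun hx => ⟨hx.1, hx.2.1, ?_⟩⟩
    · have := hx.2.2
      rw [hFeq] at this
      rw [← pairing_weightedPoint]
      exact this.2
    · rw [hFeq]
      exact ⟨subset_convexHull ℝ _ ⟨x, ⟨hx.1, hx.2.1⟩, rfl⟩,
        by rw [pairing_weightedPoint]; exact hx.2.2⟩
  have hsub : ∀ x ∈ faceVectors ι L₀ w F, x ∈ L₀ ∧ x ≠ 0 := fun x hx => ⟨hx.1, hx.2.1⟩
  have hZo : Z ∈ openCell ι L₀ w (faceVectors ι L₀ w F) := by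
    refine ⟨hZ, fun x hx => ?_, fun x hx hx0 hxM => ?_⟩
    · rw [hM] at hx
      exact hx.2.2
    · refine lt_of_le_of_ne (hZ1 x hx hx0) fun heq => hxM ?_
      rw [hM]
      exact ⟨hx, hx0, heq.symm⟩
  have hconv : F = convexHull ℝ (weightedPoint ι w '' faceVectors ι L₀ w F) := by
    rw [convexHull_eq_setOf_pairing_eq_one hsub hZo]
    exact hFeq
  obtain ⟨p, hp⟩ := intrinsicInterior_nonempty_of_convex
    (hF.exposed.convex (convex_convexHull ℝ _)) hF.nonempty
  have hpF : p ∈ convexHull ℝ (weightedPoint ι w '' faceVectors ι L₀ w F) :=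
    hconv ▸ intrinsicInterior_subset hp
  have hne : (faceVectors ι L₀ w F).Nonempty := by
    rw [← Set.image_nonempty (f := weightedPoint ι w), ← convexHull_nonempty_iff (𝕜 := ℝ)]
    exact ⟨p, hpF⟩
  refine ⟨⟨?_, hsub, ⟨Z, hZo⟩, fun Z' hZ' => ⟨hZ'.1, ⟨?_, ?_⟩, ?_⟩⟩, hconv⟩
  · rw [hM]
    exact (h.finite_weighted_le hZ 1).subset fun x hx => ⟨hx.1, hx.2.1, hx.2.2.le⟩
  · obtain ⟨x, hx⟩ := hne
    exact ⟨x, hsub x hx, hZ'.2.1 x hx⟩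
  · rintro _ ⟨x, hx, rfl⟩
    exact one_le_of_mem_openCell hZ' hx.1 hx.2
  · rw [minimalVectors_eq_of_mem_openCell hsub hZ']
    exact h.span_eq_top (hF.interior_subset hp) hpF

theorem exists_orderIso :
    ∃ Φ : {F // IsHecketopeFace ι L₀ w F} ≃o {C // IsCell ι L₀ w C}ᵒᵈ,
      ∀ F, IsCellIndex ι L₀ w (faceVectors ι L₀ w F.1) ∧
        F.1 = convexHull ℝ (weightedPoint ι w '' faceVectors ι L₀ w F.1) ∧
        (OrderDual.ofDual (Φ F)).1 = closedCell ι L₀ w (faceVectors ι L₀ w F.1) := by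
  have hidx := fun F : {F // IsHecketopeFace ι L₀ w F} => h.isCellIndex_faceVectors F.2
  let f : {F // IsHecketopeFace ι L₀ w F} → {C // IsCell ι L₀ w C}ᵒᵈ := fun F =>
    OrderDual.toDual ⟨closedCell ι L₀ w (faceVectors ι L₀ w F.1), _, (hidx F).1, rfl⟩
  have hf : ∀ F F', f F ≤ f F' ↔ F ≤ F' := fun F F' => by
    change closedCell ι L₀ w (faceVectors ι L₀ w F'.1) ⊆
      closedCell ι L₀ w (faceVectors ι L₀ w F.1) ↔ F.1 ⊆ F'.1
    rw [closedCell_subset_iff (hidx F).1 (hidx F').1]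
    refine ⟨fun hle => ?_, fun hle x hx => ⟨hx.1, hx.2.1, hle hx.2.2⟩⟩
    rw [(hidx F).2, (hidx F').2]
    exact convexHull_mono (Set.image_mono hle)
  have hsurj : Function.Surjective f := by
    rintro ⟨C, M, hM, rfl⟩
    refine ⟨⟨_, h.isHecketopeFace_convexHull hM⟩, Subtype.ext ?_⟩
    change closedCell ι L₀ w (faceVectors ι L₀ w (convexHull ℝ (weightedPoint ι w '' M))) = _
    rw [hM.faceVectors_convexHull]
  exact ⟨RelIso.ofSurjective (OrderEmbedding.ofMapLEIff f hf) hsurj,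
    fun F => ⟨(hidx F).1, (hidx F).2, rfl⟩⟩

end IsAdmissible

end Correspondence

/-! ### The conjugate transpose is a positive involution -/

section PositiveFunctional

/-- There is a `*`-invariant real functional `ρ` on `S` with `ρ (s^* s) > 0` for `s ≠ 0`. This
passes to matrix algebras and products, with no computation of traces of multiplications. -/
def HasPositiveFunctional (S : Type*) [Ring S] [StarRing S] [Algebra ℝ S] : Prop :=
  ∃ ρ : S →ₗ[ℝ] ℝ, (∀ s, ρ (star s) = ρ s) ∧ ∀ s, s ≠ 0 → 0 < ρ (star s * s)

theorem hasPositiveFunctional_real : HasPositiveFunctional ℝ :=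
  ⟨LinearMap.id, fun s => by simp, fun s hs => by
    simpa using mul_self_pos.mpr hs⟩

theorem hasPositiveFunctional_complex : HasPositiveFunctional ℂ :=
  ⟨Complex.reLm, fun s => by simp, fun s hs => by
    have := Complex.normSq_pos.mpr hs
    simpa [Complex.normSq_apply] using this⟩

instance instStarModuleRealQuaternion : StarModule ℝ ℍ[ℝ] :=
  ⟨fun r q => by rw [star_trivial r]; ext <;> simp⟩

theorem hasPositiveFunctional_quaternion : HasPositiveFunctional ℍ[ℝ] :=
  ⟨QuaternionAlgebra.reₗ (-1 : ℝ) 0 (-1), Quaternion.re_star, fun s hs => by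
    have hpos : 0 < Quaternion.normSq s :=
      lt_of_le_of_ne Quaternion.normSq_nonneg (Quaternion.normSq_ne_zero.mpr hs).symm
    rw [Quaternion.star_mul_self]
    exact hpos⟩

namespace HasPositiveFunctional

theorem nonneg {S : Type*} [Ring S] [StarRing S] [Algebra ℝ S] {ρ : S →ₗ[ℝ] ℝ}
    (hρ : ∀ s, s ≠ 0 → 0 < ρ (star s * s)) (s : S) : 0 ≤ ρ (star s * s) := by
  rcases eq_or_ne s 0 with rfl | hs
  · simp
  · exact (hρ s hs).le

theorem matrix {S : Type*} [Ring S] [StarRing S] [Algebra ℝ S] (h : HasPositiveFunctional S)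
    (m : Type*) [Fintype m] [DecidableEq m] : HasPositiveFunctional (Matrix m m S) := by
  obtain ⟨ρ, hstar, hpos⟩ := h
  refine ⟨ρ ∘ₗ Matrix.traceLinearMap m ℝ S, fun A => ?_, fun A hA => ?_⟩
  · simp [Matrix.star_eq_conjTranspose, Matrix.trace_conjTranspose, hstar]
  · have : (ρ ∘ₗ Matrix.traceLinearMap m ℝ S) (star A * A) =
        ∑ i, ∑ j, ρ (star (A j i) * A j i) := by
      simp [Matrix.trace, Matrix.mul_apply, Matrix.star_apply]
    rw [this]
    obtain ⟨j, hj⟩ := Function.ne_iff.mp hA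
    obtain ⟨i, hi⟩ := Function.ne_iff.mp hj
    exact Finset.sum_pos' (fun i _ => Finset.sum_nonneg fun j _ => nonneg hpos _)
      ⟨i, Finset.mem_univ i, Finset.sum_pos' (fun j _ => nonneg hpos _)
        ⟨j, Finset.mem_univ j, hpos _ hi⟩⟩

theorem pi {I : Type*} [Fintype I] {S : I → Type*} [∀ i, Ring (S i)] [∀ i, StarRing (S i)]
    [∀ i, Algebra ℝ (S i)] (h : ∀ i, HasPositiveFunctional (S i)) :
    HasPositiveFunctional (∀ i, S i) := by
  choose ρ hstar hpos using h
  refine ⟨∑ i, ρ i ∘ₗ LinearMap.proj i, fun s => by simp [hstar], fun s hs => ?_⟩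
  simp only [LinearMap.sum_apply, LinearMap.comp_apply, LinearMap.proj_apply, Pi.mul_apply,
    Pi.star_apply]
  obtain ⟨i, hi⟩ := Function.ne_iff.mp hs
  exact Finset.sum_pos' (fun i _ => nonneg (hpos i) _) ⟨i, Finset.mem_univ i, hpos i _ hi⟩

theorem prod {S T : Type*} [Ring S] [StarRing S] [Algebra ℝ S] [Ring T] [StarRing T] [Algebra ℝ T]
    (hS : HasPositiveFunctional S) (hT : HasPositiveFunctional T) :
    HasPositiveFunctional (S × T) := by
  obtain ⟨ρ, hρ, hρ'⟩ := hS
  obtain ⟨σ, hσ, hσ'⟩ := hT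
  refine ⟨ρ.coprod σ, fun s => by simp [hρ, hσ], fun s hs => ?_⟩
  have h : ρ.coprod σ (star s * s) = ρ (star s.1 * s.1) + σ (star s.2 * s.2) := rfl
  rw [h]
  by_cases h1 : s.1 = 0
  · have h2 : s.2 ≠ 0 := fun h2 => hs (Prod.ext h1 h2)
    exact add_pos_of_nonneg_of_pos (nonneg hρ' _) (hσ' _ h2)
  · exact add_pos_of_pos_of_nonneg (hρ' _ h1) (nonneg hσ' _)

end HasPositiveFunctional

theorem isPositiveInvolution_archAlgebra {I J K : Type*} [Fintype I] [Fintype J] [Fintype K]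
    (r : I → ℕ) (c : J → ℕ) (h : K → ℕ) : IsPositiveInvolution (ArchAlgebra r c h) := by
  obtain ⟨ρ, hstar, hpos⟩ : HasPositiveFunctional (ArchAlgebra r c h) :=
    .prod (.pi fun i => hasPositiveFunctional_real.matrix _)
      (.prod (.pi fun i => hasPositiveFunctional_complex.matrix _)
        (.pi fun i => hasPositiveFunctional_quaternion.matrix _))
  exact isPositiveInvolution_of_functional ρ hstar hpos

end PositiveFunctional

/-! ### Lattices in `D^n` and sets of weights -/

section Arithmetic

theorem exists_bounds_temperedWeight {D : Type*} [DivisionRing D] {n : ℕ}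
    {φ : Projectivization D (Fin n → D) → ℝ}
    (hpos : ∀ l, 0 < φ l) (hfin : (Set.range φ).Finite) (M₀ : Set (Fin n → D)) {τ : ℝ}
    (hτ : 1 ≤ τ) :
    ∃ c₁ c₂ : ℝ, 0 < c₁ ∧ ∀ x : Fin n → D, x ≠ 0 →
      c₁ ≤ temperedWeight φ M₀ τ x ∧ temperedWeight φ M₀ τ x ≤ c₂ := by
  obtain ⟨c₁, hc₁, hle⟩ : ∃ c₁ : ℝ, 0 < c₁ ∧ ∀ l, c₁ ≤ φ l := by
    rcases (Set.range φ).eq_empty_or_nonempty with he | hne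
    · exact ⟨1, one_pos, fun l => absurd (Set.mem_range_self l) (he ▸ Set.notMem_empty _)⟩
    · obtain ⟨_, ⟨l, rfl⟩, hl⟩ := Set.exists_min_image _ id hfin hne
      exact ⟨φ l, hpos l, fun l' => hl _ ⟨l', rfl⟩⟩
  obtain ⟨c₂, hc₂⟩ := hfin.bddAbove
  refine ⟨c₁, τ ^ 2 * c₂, hc₁, fun x hx => ?_⟩
  have hv : vecWeight φ x = φ (Projectivization.mk D x hx) := dif_neg hx
  have h1 := hle (Projectivization.mk D x hx)
  have h2 := hc₂ (Set.mem_range_self (Projectivization.mk D x hx))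
  have hτ2 : 1 ≤ τ ^ 2 := one_le_pow₀ hτ
  unfold temperedWeight
  rw [hv]
  split_ifs
  · exact ⟨h1, by nlinarith⟩
  · exact ⟨by nlinarith, by nlinarith⟩

variable {D S : Type*} [DivisionRing D] [Algebra ℚ D] [Ring S] [Algebra ℝ S]

/-- The embedding `archEmb θ` as a ring homomorphism. -/
noncomputable def archRingHom (θ : TensorProduct ℚ ℝ D ≃ₐ[ℝ] S) : D →+* S :=
  (θ : TensorProduct ℚ ℝ D →+* S).comp
    (Algebra.TensorProduct.includeRight : D →ₐ[ℚ] TensorProduct ℚ ℝ D).toRingHom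

theorem coe_archRingHom (θ : TensorProduct ℚ ℝ D ≃ₐ[ℝ] S) : ⇑(archRingHom θ) = archEmb θ := rfl

theorem archRingHom_smul (θ : TensorProduct ℚ ℝ D ≃ₐ[ℝ] S) (q : ℚ) (d : D) :
    archRingHom θ (q • d) = (q : ℝ) • archRingHom θ d := by
  change θ ((1 : ℝ) ⊗ₜ[ℚ] (q • d)) = (q : ℝ) • θ ((1 : ℝ) ⊗ₜ[ℚ] d)
  rw [← map_smul, TensorProduct.smul_tmul', ← TensorProduct.smul_tmul, Rat.smul_def, smul_eq_mul]

theorem span_range_archRingHom (θ : TensorProduct ℚ ℝ D ≃ₐ[ℝ] S) :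
    Submodule.span ℝ (Set.range (archRingHom θ)) = ⊤ := by
  rw [eq_top_iff]
  rintro s -
  obtain ⟨t, rfl⟩ := θ.surjective s
  induction t using TensorProduct.induction_on with
  | zero => rw [map_zero]; exact zero_mem _
  | add x y hx hy => rw [map_add]; exact add_mem hx hy
  | tmul r d =>
    have : r ⊗ₜ[ℚ] d = r • ((1 : ℝ) ⊗ₜ[ℚ] d) := by
      rw [TensorProduct.smul_tmul', smul_eq_mul, mul_one]
    rw [this, map_smul]
    exact Submodule.smul_mem _ _ (Submodule.subset_span ⟨d, rfl⟩)

variable {n : ℕ}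

theorem IsZLattice.exists_nsmul_mem {L₀ : AddSubgroup (Fin n → D)} (hL₀ : IsZLattice L₀)
    (x : Fin n → D) : ∃ k : ℕ, 0 < k ∧ k • x ∈ L₀ := by
  have hx : x ∈ Submodule.span ℚ (L₀ : Set (Fin n → D)) := hL₀.2 ▸ Submodule.mem_top
  induction hx using Submodule.span_induction with
  | mem x hx => exact ⟨1, one_pos, by rwa [one_smul]⟩
  | zero => exact ⟨1, one_pos, by rw [smul_zero]; exact zero_mem _⟩
  | add x y _ _ hx hy =>
    obtain ⟨k, hk, hkx⟩ := hx
    obtain ⟨l, hl, hly⟩ := hy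
    refine ⟨k * l, Nat.mul_pos hk hl, ?_⟩
    rw [smul_add]
    refine add_mem ?_ ?_
    · rw [mul_comm, mul_smul]; exact nsmul_mem hkx l
    · rw [mul_smul]; exact nsmul_mem hly k
  | smul q x _ hx =>
    obtain ⟨k, hk, hkx⟩ := hx
    refine ⟨q.den * k, Nat.mul_pos q.den_pos hk, ?_⟩
    have : (q.den * k) • q • x = q.num • k • x := by
      rw [← Nat.cast_smul_eq_nsmul ℚ, ← Int.cast_smul_eq_zsmul ℚ, ← Nat.cast_smul_eq_nsmul ℚ,
        smul_smul, smul_smul]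
      congr 1
      push_cast
      rw [mul_right_comm, Rat.den_mul_eq_num]
    rw [this]
    exact zsmul_mem hkx _

/-- A `ℚ`-basis of `D^n` becomes an `ℝ`-basis of `S^n`. -/
theorem exists_real_basis [FiniteDimensional ℚ D] (θ : TensorProduct ℚ ℝ D ≃ₐ[ℝ] S) {N : ℕ}
    (b : Module.Basis (Fin N) ℚ (Fin n → D)) :
    ∃ e : Module.Basis (Fin N) ℝ (Fin n → S),
      ∀ x, vecEmb (archEmb θ) x = ∑ i, (b.repr x i : ℝ) • e i := by
  have hexp : ∀ x, vecEmb (archEmb θ) x = ∑ i, (b.repr x i : ℝ) • vecEmb (archEmb θ) (b i) := by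
    intro x
    funext k
    have := congrArg (fun v => archRingHom θ (v k)) (b.sum_repr x)
    simp only [Finset.sum_apply, Pi.smul_apply, map_sum, archRingHom_smul] at this
    simp only [Finset.sum_apply, Pi.smul_apply]
    exact this.symm
  have hspan : ⊤ ≤ Submodule.span ℝ (Set.range fun i => vecEmb (archEmb θ) (b i)) := by
    have hmem : ∀ x, vecEmb (archEmb θ) x ∈
        Submodule.span ℝ (Set.range fun i => vecEmb (archEmb θ) (b i)) := fun x => by
      rw [hexp]
      exact sum_mem fun i _ => Submodule.smul_mem _ _ (Submodule.subset_span ⟨i, rfl⟩)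
    intro y _
    rw [← Finset.univ_sum_single y]
    refine sum_mem fun k _ => ?_
    have hle : Submodule.span ℝ (Set.range (archRingHom θ)) ≤
        (Submodule.span ℝ (Set.range fun i => vecEmb (archEmb θ) (b i))).comap
          (LinearMap.single ℝ (fun _ : Fin n => S) k) := by
      rw [Submodule.span_le]
      rintro _ ⟨d, rfl⟩
      rw [SetLike.mem_coe, Submodule.mem_comap]
      convert hmem (Pi.single k d) using 1
      funext j
      rw [LinearMap.coe_single, vecEmb, ← coe_archRingHom]
      rcases eq_or_ne j k with rfl | hjk
      · simp
      · simp [hjk]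
    exact hle (span_range_archRingHom θ ▸ Submodule.mem_top)
  have hcard : Fintype.card (Fin N) = Module.finrank ℝ (Fin n → S) := by
    have h1 : Module.finrank ℝ S = Module.finrank ℚ D := by
      rw [← θ.toLinearEquiv.finrank_eq, Module.finrank_baseChange]
    have : Module.Finite ℝ S := Module.Finite.equiv θ.toLinearEquiv
    rw [Module.finrank_pi_fintype, h1, ← Module.finrank_pi_fintype ℚ,
      Module.finrank_eq_card_basis b]
  refine ⟨basisOfTopLeSpanOfCardEqFinrank _ hspan hcard, fun x => ?_⟩
  rw [coe_basisOfTopLeSpanOfCardEqFinrank, hexp]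

/-- `D`-linear automorphisms of `D^n` that stabilize `L₀` are elements of `Γ₀`, so a set of weights
is invariant under them. -/
theorem finite_range_weights (θ : TensorProduct ℚ ℝ D ≃ₐ[ℝ] S)
    {L₀ : AddSubgroup (Fin n → D)} (hL₀ : IsZLattice L₀)
    {φ : Projectivization D (Fin n → D) → ℝ} (hφ : IsSetOfWeights (archEmb θ) L₀ φ) :
    (Set.range φ).Finite := by
  refine finite_range_of_invariant L₀ hL₀.1 hL₀.exists_nsmul_mem φ
    fun g hg x y hx hy hxy => ?_
  let A : (Matrix (Fin n) (Fin n) D)ˣ :=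
    { val := LinearMap.toMatrixRight' g.toLinearMap
      inv := LinearMap.toMatrixRight' g.symm.toLinearMap
      val_inv := by rw [← LinearMap.toMatrixRight'_comp]; simp
      inv_val := by rw [← LinearMap.toMatrixRight'_comp]; simp }
  let γ : (Matrix (Fin n) (Fin n) S)ˣ := Units.map (archRingHom θ).mapMatrix.toMonoidHom A
  have hγ : ∀ v, vecEmb (archEmb θ) v ᵥ* (γ : Matrix (Fin n) (Fin n) S) =
      vecEmb (archEmb θ) (g v) := fun v => by
    funext i
    have h1 : v ᵥ* (A : Matrix (Fin n) (Fin n) D) = g v := by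
      rw [← Matrix.toLinearMapRight'_apply]
      simp [A]
    rw [← h1]
    exact (RingHom.map_vecMul (archRingHom θ) A v i).symm
  refine hφ.invariant γ ?_ x y hx hy ?_
  · refine Set.Subset.antisymm ?_ ?_
    · rintro _ ⟨v, hv, rfl⟩
      exact ⟨g v, (hg v).mpr hv, (hγ v).symm⟩
    · rintro _ ⟨v, hv, rfl⟩
      refine ⟨g.symm v, (hg _).mp (by rwa [g.apply_symm_apply]), ?_⟩
      change vecEmb (archEmb θ) (g.symm v) ᵥ* (γ : Matrix (Fin n) (Fin n) S) = _
      rw [hγ, g.apply_symm_apply]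
  · rw [hγ, hxy]

theorem isAdmissible_of_isZLattice [FiniteDimensional ℚ D] [StarRing S]
    (hS : IsPositiveInvolution S)
    (θ : TensorProduct ℚ ℝ D ≃ₐ[ℝ] S) {L₀ : AddSubgroup (Fin n → D)} (hL₀ : IsZLattice L₀)
    {w : (Fin n → D) → ℝ}
    (hw : ∃ c₁ c₂ : ℝ, 0 < c₁ ∧ ∀ x : Fin n → D, x ≠ 0 → c₁ ≤ w x ∧ w x ≤ c₂) :
    IsAdmissible (archEmb θ) L₀ w := by
  obtain ⟨N, b, hb⟩ := exists_basis_forall_mem_iff L₀ hL₀.1 hL₀.exists_nsmul_mem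
  obtain ⟨e, he⟩ := exists_real_basis θ b
  refine ⟨hS, ⟨N, e, fun x hx => ?_, fun z => ?_⟩, fun x y hxy => ?_, ?_, ?_⟩
  · choose z hz using (hb x).mp hx
    exact ⟨z, by rw [he]; simp [hz]⟩
  · refine ⟨∑ i, (z i : ℚ) • b i, (hb _).mpr fun i => ⟨z i, by rw [b.repr_sum_self]⟩, ?_⟩
    rw [he]
    simp only [b.repr_sum_self, Rat.cast_intCast]
  · refine b.ext_elem fun i => ?_
    have := congrArg (fun v => e.repr v i) hxy
    simp only [he, e.repr_sum_self] at this
    exact_mod_cast this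
  · rw [he]; simp
  · obtain ⟨c₁, c₂, hc, h⟩ := hw
    exact ⟨c₁, c₂, hc, fun x _ => h x⟩

end Arithmetic

end Hecketope

theorem mainTheorem6 {D : Type*} [DivisionRing D] [Algebra ℚ D] [FiniteDimensional ℚ D]
    {I J K : Type*} [Fintype I] [Fintype J] [Fintype K] (r : I → ℕ) (c : J → ℕ) (h : K → ℕ)
    (θ : TensorProduct ℚ ℝ D ≃ₐ[ℝ] Hecketope.ArchAlgebra r c h)
    (n : ℕ) (L₀ : AddSubgroup (Fin n → D)) (hL₀ : Hecketope.IsZLattice L₀)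
    (φ : Projectivization D (Fin n → D) → ℝ)
    (hφ : Hecketope.IsSetOfWeights (Hecketope.archEmb θ) L₀ φ)
    (a : (Matrix (Fin n) (Fin n) (Hecketope.ArchAlgebra r c h))ˣ)
    (ha : Hecketope.MemHeckeSemigroup (Hecketope.archEmb θ) L₀ a)
    (τ : ℝ) (hτ : 1 ≤ τ) (w : (Fin n → D) → ℝ)
    (hw : w = Hecketope.temperedWeight φ
      (Hecketope.heckeSublattice (Hecketope.archEmb θ) L₀ a) τ) :
    ∃ Φ : {F // Hecketope.IsHecketopeFace (Hecketope.archEmb θ) L₀ w F} ≃o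
        {C // Hecketope.IsCell (Hecketope.archEmb θ) L₀ w C}ᵒᵈ,
      ∀ F, Hecketope.IsCellIndex (Hecketope.archEmb θ) L₀ w
          (Hecketope.faceVectors (Hecketope.archEmb θ) L₀ w F.1) ∧
        F.1 = convexHull ℝ (Hecketope.weightedPoint (Hecketope.archEmb θ) w ''
          Hecketope.faceVectors (Hecketope.archEmb θ) L₀ w F.1) ∧
        (OrderDual.ofDual (Φ F)).1 = Hecketope.closedCell (Hecketope.archEmb θ) L₀ w
          (Hecketope.faceVectors (Hecketope.archEmb θ) L₀ w F.1) := by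
  subst hw
  exact (Hecketope.isAdmissible_of_isZLattice (Hecketope.isPositiveInvolution_archAlgebra r c h)
    θ hL₀ (Hecketope.exists_bounds_temperedWeight hφ.pos
      (Hecketope.finite_range_weights θ hL₀ hφ) _ hτ)).exists_orderIso
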